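/- Let $E_{\varepsilon\varepsilon'}$ ($\varepsilon,\varepsilon'\in\{+,-\}$) be the $2\times2$ matrix units, $\sigma^+=E_{+-}$, $\sigma^-=E_{-+}$, $\sigma^z=E_{++}-E_{--}$, and let a lower index (or an upper index $(j)$) denote the site of the chain $\mathbb Z$ on which an operator acts. Let $\beta_j$ $(j\in\mathbb Z)$ be real numbers and fix $0<c<\pi/2$. For integers $r,s$ with $n=s-r+1\ge 0$ and signs $\varepsilon'_j,\varepsilon_j$ $(r\le j\le s)$ put $j^*=2s+1-j$ and $P=\{j\mid r\le j\le s,\ \varepsilon'_j=-\}\cup\{j^*\mid r\le j\le s,\ \varepsilon_j=+\}$. If $\sharp P\ne n$, set $\langle E^{(r)}_{\varepsilon'_r\varepsilon_r}\cdots E^{(s)}_{\varepsilon'_s\varepsilon_s}\rangle=0$. If $\sharp P=n$, write $P=\{\bar1<\cdots<\bar n\}$ and set, for $\nu=\tfrac12$, \begin{align*} &\langle E^{(r)}_{\varepsilon'_r\varepsilon_r}\cdots E^{(s)}_{\varepsilon'_s\varepsilon_s}\rangle =\prod_{r\le j<k\le s}\frac{\sinh(\beta_j-\beta_k)}{\sinh\nu(\beta_j-\beta_k)}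 \int\!\cdots\!\int\prod_{l=1}^n\frac{d\alpha_l}{2\pi}\prod_{1\le l<l'\le n}\frac{\sinh(\alpha_l-\alpha_{l'})}{\sinh\nu(\alpha_l-\alpha_{l'}-\pi i)}\\ &\quad\times\prod_{\bar l\le s}\Bigl[\prod_{j=r}^s\frac{i}{\sinh(\alpha_l-\beta_j)}\prod_{r\le j<\bar l}\sinh\nu(\alpha_l-\beta_j)\prod_{\bar l<j\le s}\sinh\nu(-\alpha_l+\beta_j+\pi i)\Bigr]\\ &\quad\times\prod_{\bar l\ge s+1}\Bigl[\prod_{j=r}^s\frac{-i}{\sinh(\alpha_l-\beta_j)}\prod_{r\le j<\bar l^*}\sinh\nu(-\alpha_l+\beta_j)\prod_{\bar l^*<j\le s}\sinh\nu(\alpha_l-\beta_j+\pi i)\Bigr], \end{align*} where $\bar l^*=2s+1-\bar l$, the variable $\alpha_l$ runs from left to right over the line $\operatorname{Im}\alpha_l=c$ if $\bar l\le s$ and over $\operatorname{Im}\alpha_l=-c$ if $\bar l\ge s+1$, and the ratio in the first product is replaced by its limit $1/\nu$ when $\beta_j=\beta_k$. Extend $\langle\,\cdot\,\rangle$ linearly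 to all operators on the sites $r,\dots,s$. Let $\psi_m=\cdots\sigma^z_{m-2}\sigma^z_{m-1}\sigma^-_m$ and $\psi^*_m=\cdots\sigma^z_{m-2}\sigma^z_{m-1}\sigma^+_m$ be the Jordan–Wigner fermions; a product of an even number of them with all indices in $\{r,\dots,s\}$ is an operator on the sites $r,\dots,s$. Then all the integrals above converge absolutely, and for all $k\ge0$ and all integers $m_1,\dots,m_k,l_1,\dots,l_k$, $$\langle\psi_{m_1}\cdots\psi_{m_k}\psi^*_{l_k}\cdots\psi^*_{l_1}\rangle=\det\bigl(\langle\psi_{m_j}\psi^*_{l_i}\rangle\bigr)_{1\le j,i\le k}.$$ Here the left side and each matrix entry may be computed with any interval of sites $\{r,\dots,s\}$ containing the indices that occur in it, chosen separately for each of them. -/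

import Mathlib

open Complex MeasureTheory

noncomputable section

namespace XXZ

/-- The two spin values: `true` is `+`, `false` is `-`. -/
abbrev Spin := Bool

/-- Positions `p` of the symbols `+` in the sequence of length `2n`
`-ε'_1, …, -ε'_n, ε_n, …, ε_1`. -/
def plusPositions {n : ℕ} (ε' ε : Fin n → Spin) : Finset (Fin (n + n)) :=
  Finset.univ.filter fun p =>
    Fin.append (fun j : Fin n => !(ε' j)) (fun j : Fin n => ε j.rev) p = true

/-- The point over `x` on the contour of a variable attached to position `p`.
For a position in the first half the contour is the line `Im α = c` above the real axis,
for a position in the second half it is the line `Im α = -c` below the real axis. -/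
def contourPoint (c : ℝ) {n : ℕ} (p : Fin (n + n)) (x : ℝ) : ℂ :=
  Fin.addCases (fun _ : Fin n => (x : ℂ) + c * I) (fun _ : Fin n => (x : ℂ) - c * I) p

/-- The one-variable factor of the integrand attached to position `p`.
The position `n + q` in the second half sits at the site `q.rev`. -/
def oneBodyFactor (ν : ℝ) {n : ℕ} (b : Fin n → ℝ) (p : Fin (n + n)) (z : ℂ) : ℂ :=
  Fin.addCases
    (fun a : Fin n =>
      (∏ j, I / sinh (z - b j)) *
        (∏ j ∈ Finset.Iio a, sinh (ν * (z - b j))) *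
        ∏ j ∈ Finset.Ioi a, sinh (ν * (-z + b j + Real.pi * I)))
    (fun q : Fin n =>
      (∏ j, (-I) / sinh (z - b j)) *
        (∏ j ∈ Finset.Iio q.rev, sinh (ν * (-z + b j))) *
        ∏ j ∈ Finset.Ioi q.rev, sinh (ν * (z - b j + Real.pi * I)))
    p

/-- The integrand of the `n`-fold integral for the correlator, where `p 0 < p 1 < …` are the
positions attached to the integration variables `α_l = contourPoint c (p l) (x l)`. -/
def corrIntegrand (ν c : ℝ) {n : ℕ} (b : Fin n → ℝ) (p : Fin n → Fin (n + n))
    (x : Fin n → ℝ) : ℂ :=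
  (∏ l, (1 / (2 * Real.pi) : ℂ) * oneBodyFactor ν b (p l) (contourPoint c (p l) (x l))) *
    ∏ l, ∏ l' ∈ Finset.Ioi l,
      sinh (contourPoint c (p l) (x l) - contourPoint c (p l') (x l')) /
        sinh (ν * (contourPoint c (p l) (x l) - contourPoint c (p l') (x l') - Real.pi * I))

/-- The function `sinh t / sinh (ν t)` of a real variable, with its limiting value `1 / ν`
at `t = 0`. -/
def sinhRatio (ν t : ℝ) : ℝ :=
  if t = 0 then 1 / ν else Real.sinh t / Real.sinh (ν * t)

/-- The correlator of `E_{ε'_1 ε_1} ⊗ ⋯ ⊗ E_{ε'_n ε_n}` with real spectral parameters `b`,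
given by the `n`-fold integral. It is zero unless the sequence
`-ε'_1, …, -ε'_n, ε_n, …, ε_1` has total spin zero. -/
def elementaryCorrelator (ν c : ℝ) {n : ℕ} (b : Fin n → ℝ) (ε' ε : Fin n → Spin) : ℂ :=
  if h : (plusPositions ε' ε).card = n then
    (∏ j, ∏ k ∈ Finset.Ioi j, (sinhRatio ν (b j - b k) : ℂ)) *
      ∫ x : Fin n → ℝ, corrIntegrand ν c b ((plusPositions ε' ε).orderEmbOfFin h) x
  else 0

/-- Operators on `(ℂ²)^{⊗ n}`, as matrices indexed by spin configurations. -/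
abbrev Op (n : ℕ) := Matrix (Fin n → Spin) (Fin n → Spin) ℂ

/-- The operator `A_1 ⊗ ⋯ ⊗ A_n`. -/
def tensorOp {n : ℕ} (A : Fin n → Matrix Spin Spin ℂ) : Op n :=
  Matrix.of fun ε' ε => ∏ j, A j (ε' j) (ε j)

/-- `σ^+ = E_{+-}`. -/
def sigmaPlus : Matrix Spin Spin ℂ := Matrix.single true false 1

/-- `σ^- = E_{-+}`. -/
def sigmaMinus : Matrix Spin Spin ℂ := Matrix.single false true 1

/-- `σ^z = E_{++} - E_{--}`. -/
def sigmaZ : Matrix Spin Spin ℂ := Matrix.single true true 1 - Matrix.single false false 1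

/-- The restriction to the window of sites `r, r + 1, …, r + n - 1` of the operator
`⋯ σ^z_{m-2} σ^z_{m-1} A_m`. In a product of an even number of such operators with all
`m` in the window, the omitted factors `σ^z` to the left of the window cancel, so that the
product is a local operator and is given exactly by the product of the restrictions. -/
def jordanWigner (r : ℤ) (n : ℕ) (A : Matrix Spin Spin ℂ) (m : ℤ) : Op n :=
  tensorOp fun j : Fin n =>
    if r + (j : ℕ) < m then sigmaZ else if r + (j : ℕ) = m then A else 1

/-- `ψ_m = ⋯ σ^z_{m-2} σ^z_{m-1} σ^-_m`. -/
def psi (r : ℤ) (n : ℕ) (m : ℤ) : Op n := jordanWigner r n sigmaMinus m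

/-- `ψ*_m = ⋯ σ^z_{m-2} σ^z_{m-1} σ^+_m`. -/
def psiStar (r : ℤ) (n : ℕ) (m : ℤ) : Op n := jordanWigner r n sigmaPlus m

/-- The spectral parameters `β_r, …, β_{r+n-1}` of the window. -/
def windowParams (β : ℤ → ℝ) (r : ℤ) (n : ℕ) : Fin n → ℝ := fun j => β (r + (j : ℕ))

/-- The correlator of an operator on the window of sites `r, …, r + n - 1`, the linear
extension of the correlators of the `E_{ε'_r ε_r} ⊗ ⋯ ⊗ E_{ε'_s ε_s}`, `s = r + n - 1`. -/
def correlator (ν c : ℝ) (β : ℤ → ℝ) (r : ℤ) (n : ℕ) (O : Op n) : ℂ :=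
  ∑ ε', ∑ ε, O ε' ε * elementaryCorrelator ν c (windowParams β r n) ε' ε

/-- The monomial `ψ_{m_1} ⋯ ψ_{m_k} ψ*_{l_k} ⋯ ψ*_{l_1}`. -/
def fermionMonomial (r : ℤ) (n : ℕ) {k : ℕ} (m l : Fin k → ℤ) : Op n :=
  (List.ofFn fun j => psi r n (m j)).prod * (List.ofFn fun i => psiStar r n (l i.rev)).prod

end XXZ

end

namespace XXZ

/-! At `ν = 1/2` the integrand is itself a determinant. With S_j = 2 sinh((α - β_j)/2) and C_j = 2
cosh((α - β_j)/2), the double product over the variables and the prefactor in the β's combine into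
the determinant of the functions ∏_{j<b} C_j ∏_{j>b} S_j at the points α_l, a Vandermonde
determinant in disguise (`det_columnFun`). After the one-variable factors are absorbed, row l
depends on α_l alone (`prefactor_mul_corrIntegrand`) and its entries are integrable. Hence the
integral converges absolutely and equals, up to a constant, the maximal minor with row set P of one
fixed 2n × n matrix W (`elementaryCorrelator_eq`).

Maximal minors satisfy linear Plücker relations (`sum_minorAmplitude_erase`). Multiplication by ψ*_a
from the left or from the right removes one element of P, and the Jordan–Wigner string is the
Laplace sign of the removed row up to a sign depending only on n and a. The Plücker relation thus
becomes a linear relation between the values ⟨ψ*_a X⟩ and ⟨X ψ*_a⟩ (`sum_minorFunctional_psiStar`).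

The two rows of W over the same site integrate, up to constants, the same kernel over the upper and
the lower line. Their difference is a residue, present only on the diagonal
(`integral_siteKernel_neg`). So the relation reads ⟨X ψ*_b⟩ = Σ_a G(a,b) ⟨ψ*_a X + X ψ*_a⟩. For a
monomial X the anticommutator deletes one ψ, and what results is the Laplace expansion of the
determinant along its first column (`minorFunctional_fermionMonomial`). The same diagonal difference
gives ⟨1⟩ = 1. Finally G(m,l) involves only the sites from m to l, so the choice of window is
immaterial. -/

/-! ### Jordan–Wigner operators and their anticommutation relations -/

lemma tensorOp_mul {n : ℕ} (A B : Fin n → Matrix Spin Spin ℂ) :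
    tensorOp A * tensorOp B = tensorOp fun j => A j * B j := by
  ext x y
  simp only [tensorOp, Matrix.mul_apply, Matrix.of_apply, ← Finset.prod_mul_distrib]
  rw [Finset.prod_univ_sum, Fintype.piFinset_univ]

lemma tensorOp_one {n : ℕ} : tensorOp (fun _ : Fin n => 1) = 1 := by
  ext x y
  simp only [tensorOp, Matrix.of_apply, Matrix.one_apply, Finset.prod_ite_zero, funext_iff]
  simp

lemma tensorOp_add {n : ℕ} {P Q R : Fin n → Matrix Spin Spin ℂ} (i : Fin n)
    (h : P i + Q i = R i) (hP : ∀ j, j ≠ i → P j = R j) (hQ : ∀ j, j ≠ i → Q j = R j) :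
    tensorOp P + tensorOp Q = tensorOp R := by
  ext x y
  have key : ∀ T : Fin n → Matrix Spin Spin ℂ, (∀ j, j ≠ i → T j = R j) →
      tensorOp T x y = T i (x i) (y i) * ∏ j ∈ Finset.univ.erase i, R j (x j) (y j) := by
    intro T hT
    simp only [tensorOp, Matrix.of_apply]
    rw [← Finset.mul_prod_erase _ _ (Finset.mem_univ i)]
    congr 1
    exact Finset.prod_congr rfl fun j hj => by rw [hT j (Finset.ne_of_mem_erase hj)]
  rw [Matrix.add_apply, key P hP, key Q hQ, key R fun _ _ => rfl, ← h, Matrix.add_apply, add_mul]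

lemma tensorOp_eq_zero {n : ℕ} {R : Fin n → Matrix Spin Spin ℂ} (i : Fin n) (h : R i = 0) :
    tensorOp R = 0 := by
  ext x y
  exact Finset.prod_eq_zero (Finset.mem_univ i) (by simp [h])

/-- The two products agree at every site except `a`, where `A` meets the `sigmaZ` of the longer
string and anticommutes with it. No property of `B` enters. -/
lemma jordanWigner_anticomm_of_lt {r : ℤ} {n : ℕ} {A : Matrix Spin Spin ℂ}
    (B : Matrix Spin Spin ℂ) (hA : A * sigmaZ + sigmaZ * A = 0) {a m : ℤ} (h : a < m)
    (ha : a ∈ Set.Ico r (r + n)) :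
    jordanWigner r n A a * jordanWigner r n B m + jordanWigner r n B m * jordanWigner r n A a
      = 0 := by
  obtain ⟨i, rfl⟩ : ∃ i : Fin n, a = r + (i : ℕ) :=
    ⟨⟨(a - r).toNat, by have := ha.1; have := ha.2; omega⟩, by
      have := ha.1; simp only []; omega⟩
  simp only [jordanWigner, tensorOp_mul]
  rw [tensorOp_add (R := fun j => if j = i then 0 else
    (if r + ((j : ℕ) : ℤ) < r + ((i : ℕ) : ℤ) then sigmaZ else
      if r + ((j : ℕ) : ℤ) = r + ((i : ℕ) : ℤ) then A else 1) *
      (if r + ((j : ℕ) : ℤ) < m then sigmaZ else if r + ((j : ℕ) : ℤ) = m then B else 1)) i]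
  · exact tensorOp_eq_zero i (by simp)
  · simp [h, hA]
  · intro j hj
    simp [hj]
  · intro j hj
    have : (j : ℕ) ≠ i := fun h => hj (Fin.ext h)
    rcases lt_or_gt_of_ne this with h1 | h1
    · have : r + ((j : ℕ) : ℤ) < m := by omega
      simp [h1, hj, this]
    · have h2 : ¬ ((j : ℕ) < i) := by omega
      simp [h2, hj, this]

lemma jordanWigner_anticomm_of_ne {r : ℤ} {n : ℕ} {A B : Matrix Spin Spin ℂ}
    (hA : A * sigmaZ + sigmaZ * A = 0) (hB : B * sigmaZ + sigmaZ * B = 0) {a m : ℤ} (h : a ≠ m)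
    (ha : a ∈ Set.Ico r (r + n)) (hm : m ∈ Set.Ico r (r + n)) :
    jordanWigner r n A a * jordanWigner r n B m + jordanWigner r n B m * jordanWigner r n A a
      = 0 := by
  rcases lt_or_gt_of_ne h with h | h
  · exact jordanWigner_anticomm_of_lt B hA h ha
  · rw [add_comm]
    exact jordanWigner_anticomm_of_lt A hB h hm

lemma sigmaZ_mul_self : sigmaZ * sigmaZ = 1 := by
  ext i j
  cases i <;> cases j <;> simp [sigmaZ, Matrix.mul_apply, Matrix.single]

lemma jordanWigner_anticomm_self {r : ℤ} {n : ℕ} {A B : Matrix Spin Spin ℂ} {a : ℤ}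
    (ha : a ∈ Set.Ico r (r + n)) :
    jordanWigner r n A a * jordanWigner r n B a + jordanWigner r n B a * jordanWigner r n A a
      = tensorOp fun j : Fin n => if r + (j : ℕ) = a then A * B + B * A else 1 := by
  obtain ⟨i, rfl⟩ : ∃ i : Fin n, a = r + (i : ℕ) :=
    ⟨⟨(a - r).toNat, by have := ha.1; have := ha.2; omega⟩, by
      have := ha.1; simp only []; omega⟩
  simp only [jordanWigner, tensorOp_mul]
  apply tensorOp_add i
  · simp
  all_goals
    intro j hj
    have : (j : ℕ) ≠ i := fun h => hj (Fin.ext h)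
    by_cases h1 : (j : ℕ) < i
    · simp [h1, this, sigmaZ_mul_self]
    · simp [h1, this]

lemma sigmaPlus_anticomm_sigmaZ : sigmaPlus * sigmaZ + sigmaZ * sigmaPlus = 0 := by
  ext i j
  cases i <;> cases j <;> simp [sigmaZ, sigmaPlus, Matrix.mul_apply, Matrix.single]

lemma sigmaMinus_anticomm_sigmaZ : sigmaMinus * sigmaZ + sigmaZ * sigmaMinus = 0 := by
  ext i j
  cases i <;> cases j <;> simp [sigmaZ, sigmaMinus, Matrix.mul_apply, Matrix.single]

lemma psiStar_anticomm_psiStar {r : ℤ} {n : ℕ} {a m : ℤ}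
    (ha : a ∈ Set.Ico r (r + n)) (hm : m ∈ Set.Ico r (r + n)) :
    psiStar r n a * psiStar r n m + psiStar r n m * psiStar r n a = 0 := by
  by_cases h : a = m
  · subst h
    obtain ⟨i, rfl⟩ : ∃ i : Fin n, a = r + (i : ℕ) :=
      ⟨⟨(a - r).toNat, by have := ha.1; have := ha.2; omega⟩, by
        have := ha.1; simp only []; omega⟩
    rw [psiStar, jordanWigner_anticomm_self ha]
    refine tensorOp_eq_zero i ?_
    simp [sigmaPlus]
  · exact jordanWigner_anticomm_of_ne sigmaPlus_anticomm_sigmaZ sigmaPlus_anticomm_sigmaZ h ha hm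

lemma psiStar_anticomm_psi {r : ℤ} {n : ℕ} {a m : ℤ}
    (ha : a ∈ Set.Ico r (r + n)) (hm : m ∈ Set.Ico r (r + n)) :
    psiStar r n a * psi r n m + psi r n m * psiStar r n a = if a = m then 1 else 0 := by
  split_ifs with h
  · subst h
    rw [psiStar, psi, jordanWigner_anticomm_self ha, ← tensorOp_one]
    congr 1
    ext j x y
    have : sigmaPlus * sigmaMinus + sigmaMinus * sigmaPlus = 1 := by
      ext i j
      cases i <;> cases j <;> simp [sigmaPlus, sigmaMinus, Matrix.mul_apply, Matrix.single]
    simp [this]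
  · exact jordanWigner_anticomm_of_ne sigmaPlus_anticomm_sigmaZ sigmaMinus_anticomm_sigmaZ h ha hm

/-- Moving `a` to the right through a product of elements anticommuting with it. -/
lemma mul_prod_ofFn_of_anticomm {R : Type*} [Ring R] (a : R) {k : ℕ} (f : Fin k → R)
    (h : ∀ i, a * f i + f i * a = 0) :
    a * (List.ofFn f).prod = (-1) ^ k * ((List.ofFn f).prod * a) := by
  induction k with
  | zero => simp
  | succ k ih =>
    rw [List.ofFn_succ, List.prod_cons, ← mul_assoc, eq_neg_of_add_eq_zero_left (h 0),
      neg_mul, mul_assoc, ih _ fun i => h i.succ, pow_succ]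
    simp only [mul_neg, mul_one, neg_mul, ← mul_assoc]
    rw [((Commute.neg_one_right (f 0)).pow_right k).eq]

/-- Moving `a` to the right through a product of elements whose anticommutators with `a` are
scalars produces the sum of the contractions. -/
lemma mul_prod_ofFn_of_anticomm_scalar {R : Type*} [Ring R] [Algebra ℂ R] (a : R) {k : ℕ}
    (f : Fin (k + 1) → R) (s : Fin (k + 1) → ℂ) (h : ∀ i, a * f i + f i * a = s i • (1 : R)) :
    a * (List.ofFn f).prod = (∑ j : Fin (k + 1), ((-1) ^ (j : ℕ) * s j) •
      (List.ofFn fun i : Fin k => f (j.succAbove i)).prod) +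
        (-1) ^ (k + 1) * ((List.ofFn f).prod * a) := by
  induction k with
  | zero =>
    have := eq_sub_of_add_eq (h 0)
    simp [this, sub_eq_add_neg]
  | succ k ih =>
    have ih' := ih (fun i => f i.succ) (fun i => s i.succ) fun i => h i.succ
    rw [List.ofFn_succ, List.prod_cons, ← mul_assoc, eq_sub_of_add_eq (h 0), sub_mul, mul_assoc,
      ih', Fin.sum_univ_succ (n := k + 1), mul_add, Finset.mul_sum]
    have e : f 0 * ((-1) ^ (k + 1) * ((List.ofFn fun i : Fin (k + 1) => f i.succ).prod * a)) =
        - ((-1) ^ (k + 1 + 1) * (f 0 * (List.ofFn fun i : Fin (k + 1) => f i.succ).prod * a)) := by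
      rw [pow_succ (-1 : R) (k + 1), ← mul_assoc, ((Commute.neg_one_right (f 0)).pow_right _).eq]
      simp only [mul_neg, mul_one, neg_mul, neg_neg, mul_assoc]
    rw [e]
    simp only [Fin.val_zero, pow_zero, one_mul, Fin.zero_succAbove, smul_mul_assoc, one_mul,
      Fin.val_succ]
    have e2 : ∀ j : Fin (k + 1),
        (List.ofFn fun i : Fin (k + 1) => f (j.succ.succAbove i)).prod =
        f 0 * (List.ofFn fun i : Fin k => f (j.succAbove i).succ).prod := by
      intro j
      rw [List.ofFn_succ]
      simp
    simp only [e2, pow_succ (-1 : ℂ), mul_neg, mul_one, neg_mul, neg_smul, Finset.sum_neg_distrib,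
      mul_smul_comm]
    abel

/-! ### Functionals given by maximal minors, and the Plücker relation -/

/-- The maximal minors of `W`, times `κ`, as a function of the set of rows. -/
noncomputable def minorAmplitude {N n : ℕ} (κ : ℂ) (W : Fin N → Fin n → ℂ)
    (Q : Finset (Fin N)) : ℂ :=
  if h : Q.card = n then κ * Matrix.det (Matrix.of fun l b => W (Q.orderEmbOfFin h l) b) else 0

/-- The linear functional on operators whose values on matrix units are maximal minors of `W`. -/
noncomputable def minorFunctional {n : ℕ} (κ : ℂ) (W : Fin (n + n) → Fin n → ℂ) (O : Op n) : ℂ :=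
  ∑ ε', ∑ ε, O ε' ε * minorAmplitude κ W (plusPositions ε' ε)

/-- This identifies the exponent of the Laplace sign with a count of the elements of `Q` below the
removed one, the form in which it is compared with a Jordan–Wigner string. -/
lemma card_filter_lt_orderEmbOfFin {N k : ℕ} (Q : Finset (Fin N)) (h : Q.card = k) (i : Fin k) :
    (Q.filter (· < Q.orderEmbOfFin h i)).card = i := by
  have : Q.filter (· < Q.orderEmbOfFin h i) =
      (Finset.Iio i).map (Q.orderEmbOfFin h).toEmbedding := by
    ext q
    constructor
    · intro hq
      obtain ⟨hq, hlt⟩ := Finset.mem_filter.1 hq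
      rw [← Finset.map_orderEmbOfFin_univ Q h] at hq
      obtain ⟨j, -, rfl⟩ := Finset.mem_map.1 hq
      exact Finset.mem_map.2 ⟨j, by simpa using hlt, rfl⟩
    · intro hq
      obtain ⟨j, hj, rfl⟩ := Finset.mem_map.1 hq
      refine Finset.mem_filter.2 ⟨Finset.orderEmbOfFin_mem _ _ _, ?_⟩
      simpa using hj
  rw [this, Finset.card_map, Fin.card_Iio]

lemma orderEmbOfFin_erase {N k : ℕ} (Q : Finset (Fin N)) (h : Q.card = k + 1) (i : Fin (k + 1))
    (h' : (Q.erase (Q.orderEmbOfFin h i)).card = k) (l : Fin k) :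
    (Q.erase (Q.orderEmbOfFin h i)).orderEmbOfFin h' l = Q.orderEmbOfFin h (i.succAbove l) := by
  refine (congrFun (Finset.orderEmbOfFin_unique h'
    (f := fun l => Q.orderEmbOfFin h (i.succAbove l)) ?_ ?_) l).symm
  · intro x
    refine Finset.mem_erase.2 ⟨?_, Finset.orderEmbOfFin_mem _ _ _⟩
    rw [Ne, (Q.orderEmbOfFin h).injective.eq_iff]
    exact Fin.succAbove_ne i x
  · exact (Q.orderEmbOfFin h).strictMono.comp (Fin.strictMono_succAbove i)

/-- The linear Plücker relation between the minors with one row removed from `Q`. -/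
lemma sum_minorAmplitude_erase {N n : ℕ} (κ : ℂ) (W : Fin N → Fin n → ℂ) (Q : Finset (Fin N))
    (b : Fin n) :
    ∑ p ∈ Q, (-1) ^ (Q.filter (· < p)).card * W p b * minorAmplitude κ W (Q.erase p) = 0 := by
  by_cases h : Q.card = n + 1
  -- Column `b` is repeated in front of the n columns, so the determinant vanishes; expanding it
  -- along the front copy gives the relation.
  · let M : Matrix (Fin (n + 1)) (Fin (n + 1)) ℂ :=
      Matrix.of fun i j => W (Q.orderEmbOfFin h i) (Fin.cons (α := fun _ => Fin n) b id j)
    have hM : M.det = 0 :=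
      Matrix.det_zero_of_column_eq (Fin.succ_ne_zero b).symm fun i => by simp [M]
    rw [Matrix.det_succ_column_zero] at hM
    have : ∀ F : Fin N → ℂ, ∑ p ∈ Q, F p = ∑ i, F (Q.orderEmbOfFin h i) := by
      intro F
      conv_lhs => rw [← Finset.map_orderEmbOfFin_univ Q h, Finset.sum_map]
      rfl
    rw [this, ← mul_zero κ, ← hM, Finset.mul_sum]
    refine Finset.sum_congr rfl fun i _ => ?_
    have hc : (Q.erase (Q.orderEmbOfFin h i)).card = n := by
      rw [Finset.card_erase_of_mem (Finset.orderEmbOfFin_mem _ _ _), h]; rfl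
    rw [card_filter_lt_orderEmbOfFin, minorAmplitude, dif_pos hc]
    simp only [orderEmbOfFin_erase]
    have : M.submatrix i.succAbove Fin.succ =
        Matrix.of fun l b => W (Q.orderEmbOfFin h (i.succAbove l)) b := by
      ext; simp [M]
    rw [this]
    simp only [M, Matrix.of_apply, Fin.cons_zero]
    ring
  · refine Finset.sum_eq_zero fun p hp => ?_
    have : ¬ (Q.erase p).card = n := by
      rw [Finset.card_erase_of_mem hp]
      have := Finset.card_pos.2 ⟨p, hp⟩
      omega
    rw [minorAmplitude, dif_neg this, mul_zero]

/-! ### Action of ψ* on spin configurations and on positions -/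

section positions

variable {n : ℕ} (η ε : Fin n → Spin) (a : Fin n)

lemma castAdd_mem_plusPositions : Fin.castAdd n a ∈ plusPositions η ε ↔ η a = false := by
  simp [plusPositions, -Fin.natAdd_eq_addNat]

lemma natAdd_mem_plusPositions : Fin.natAdd n a ∈ plusPositions η ε ↔ ε a.rev = true := by
  simp [plusPositions, -Fin.natAdd_eq_addNat]

/-- Raising a spin on the left, or lowering one on the right, deletes a single position. This is how
ψ* turns into the removal of a row of a minor. -/
lemma plusPositions_update_left :
    plusPositions (Function.update η a true) ε = (plusPositions η ε).erase (Fin.castAdd n a) := by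
  ext p
  refine Fin.addCases (fun j => ?_) (fun j => ?_) p
  · by_cases h : j = a
    · subst h; simp [castAdd_mem_plusPositions]
    · simp [castAdd_mem_plusPositions, h]
  · have : Fin.natAdd n j ≠ Fin.castAdd n a := by
      simp only [ne_eq, Fin.ext_iff, Fin.val_natAdd, Fin.val_castAdd]; omega
    simp [-Fin.natAdd_eq_addNat, natAdd_mem_plusPositions, this]

lemma plusPositions_update_right :
    plusPositions η (Function.update ε a false) =
      (plusPositions η ε).erase (Fin.natAdd n a.rev) := by
  ext p
  refine Fin.addCases (fun j => ?_) (fun j => ?_) p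
  · have : Fin.castAdd n j ≠ Fin.natAdd n a.rev := by
      simp only [ne_eq, Fin.ext_iff, Fin.val_natAdd, Fin.val_castAdd]; omega
    simp [castAdd_mem_plusPositions, this, -Fin.natAdd_eq_addNat]
  · by_cases h : j.rev = a
    · subst h; simp [-Fin.natAdd_eq_addNat, natAdd_mem_plusPositions]
    · have : j ≠ a.rev := fun h' => h (by simp [h'])
      simp [-Fin.natAdd_eq_addNat, natAdd_mem_plusPositions, h, this]

/-- The sign of the string `σ^z ⋯ σ^z` on the sites to the left of `a`. -/
noncomputable def stringSign : ℂ := ∏ j ∈ Finset.Iio a, if η j then 1 else -1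

lemma prod_Iio_eq_prod_ite {n : ℕ} (a : Fin n) (f : Fin n → ℂ) :
    ∏ j ∈ Finset.Iio a, f j = ∏ j, if j < a then f j else 1 := by
  rw [← Finset.prod_filter]
  congr 1
  ext; simp

lemma neg_one_pow_card_filter {N : ℕ} (Q : Finset (Fin N)) (P : Fin N → Prop) [DecidablePred P] :
    (-1 : ℂ) ^ (Q.filter P).card = ∏ q, if q ∈ Q ∧ P q then -1 else 1 := by
  rw [← Finset.prod_const, ← Finset.prod_filter]
  congr 1
  ext; simp

/-- The positions counted are the sites j < a with η_j = -, exactly those where σ^z has eigenvalue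
-1; so the Laplace sign is the Jordan–Wigner string. -/
lemma neg_one_pow_card_filter_lt_castAdd :
    (-1 : ℂ) ^ ((plusPositions η ε).filter (· < Fin.castAdd n a)).card = stringSign η a := by
  rw [neg_one_pow_card_filter, Fin.prod_univ_add, stringSign, prod_Iio_eq_prod_ite]
  have : ∀ j : Fin n, ¬ Fin.natAdd n j < Fin.castAdd n a := by
    intro j; simp only [Fin.lt_def, Fin.val_natAdd, Fin.val_castAdd]; omega
  simp only [castAdd_mem_plusPositions, this, and_false, if_false, Finset.prod_const_one, mul_one]
  refine Finset.prod_congr rfl fun j _ => ?_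
  simp only [show Fin.castAdd n j < Fin.castAdd n a ↔ j < a from Iff.rfl]
  by_cases h : j < a <;> cases h' : η j <;> simp [h]

/-- The second half lists the sites backwards, so the positions beyond that of `a` are the sites j <
a with ε_j = +. The string counts the spins - instead, and the factor (-1)^a makes up for this. -/
lemma neg_one_pow_card_filter_gt_natAdd :
    (-1 : ℂ) ^ ((plusPositions η ε).filter (Fin.natAdd n a.rev < ·)).card =
      (-1) ^ (a : ℕ) * stringSign ε a := by
  have h1 : ∀ j : Fin n, ¬ Fin.natAdd n a.rev < Fin.castAdd n j := by
    intro j; simp only [Fin.lt_def, Fin.val_natAdd, Fin.val_castAdd]; omega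
  have h2 : (-1 : ℂ) ^ (a : ℕ) = ∏ j ∈ Finset.Iio a, -1 := by
    rw [Finset.prod_const, Fin.card_Iio]
  have h3 : ∏ j : Fin n, (if Fin.castAdd n j ∈ plusPositions η ε ∧
      Fin.natAdd n a.rev < Fin.castAdd n j then (-1 : ℂ) else 1) = 1 :=
    Finset.prod_eq_one fun j _ => if_neg fun h => h1 j h.2
  rw [neg_one_pow_card_filter, Fin.prod_univ_add, h3, one_mul, stringSign, h2,
    ← Finset.prod_mul_distrib, prod_Iio_eq_prod_ite,
    ← Equiv.prod_comp (Fin.revPerm : Equiv.Perm (Fin n))]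
  refine Finset.prod_congr rfl fun j _ => ?_
  have : Fin.natAdd n a.rev < Fin.natAdd n j.rev ↔ j < a := by
    rw [Fin.natAdd_lt_natAdd_iff, Fin.rev_lt_rev]
  simp only [Fin.revPerm_apply, natAdd_mem_plusPositions, Fin.rev_rev, this]
  by_cases h : j < a <;> cases h' : ε j <;> simp [h]

/-- Of the n + 1 positions, n are different from the one over `a`, so the number below it and the
number above it add up to n. -/
lemma neg_one_pow_card_filter_lt_natAdd (hQ : (plusPositions η ε).card = n + 1)
    (ha : ε a = true) :
    (-1 : ℂ) ^ ((plusPositions η ε).filter (· < Fin.natAdd n a.rev)).card =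
      (-1) ^ (n + (a : ℕ)) * stringSign ε a := by
  set Q := plusPositions η ε with hQd
  set p := Fin.natAdd n a.rev with hp
  have hpQ : p ∈ Q := by simp [-Fin.natAdd_eq_addNat, hp, hQd, natAdd_mem_plusPositions, ha]
  have hcard : (Q.filter (· < p)).card + (Q.filter (p < ·)).card = n := by
    rw [← Finset.card_union_of_disjoint]
    · have : Q.filter (· < p) ∪ Q.filter (p < ·) = Q.erase p := by
        ext q
        simp only [Finset.mem_union, Finset.mem_filter, Finset.mem_erase]
        constructor
        · rintro (⟨h, h'⟩ | ⟨h, h'⟩)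
          exacts [⟨h'.ne, h⟩, ⟨h'.ne', h⟩]
        · rintro ⟨h, h'⟩
          rcases lt_or_gt_of_ne h with h | h
          exacts [Or.inl ⟨h', h⟩, Or.inr ⟨h', h⟩]
      rw [this, Finset.card_erase_of_mem hpQ, hQ]; rfl
    · rw [Finset.disjoint_left]
      intro q h h'
      exact lt_asymm (Finset.mem_filter.1 h).2 (Finset.mem_filter.1 h').2
  have h1 := neg_one_pow_card_filter_gt_natAdd η ε a
  have h2 : (-1 : ℂ) ^ (Q.filter (p < ·)).card * (-1 : ℂ) ^ (Q.filter (p < ·)).card = 1 := by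
    rw [← mul_pow]; simp
  calc (-1 : ℂ) ^ (Q.filter (· < p)).card
      = (-1 : ℂ) ^ (Q.filter (· < p)).card *
        ((-1 : ℂ) ^ (Q.filter (p < ·)).card * (-1 : ℂ) ^ (Q.filter (p < ·)).card) := by
          rw [h2, mul_one]
    _ = (-1 : ℂ) ^ n * (-1 : ℂ) ^ (Q.filter (p < ·)).card := by
          rw [← mul_assoc, ← pow_add, hcard]
    _ = _ := by rw [h1, pow_add]; ring

lemma psiStar_apply (r : ℤ) (x y : Fin n → Spin) :
    psiStar r n (r + (a : ℕ)) x y =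
      if y a = false ∧ x = Function.update y a true then stringSign y a else 0 := by
  simp only [psiStar, jordanWigner, tensorOp, Matrix.of_apply]
  split_ifs with h
  · obtain ⟨h1, rfl⟩ := h
    rw [stringSign, prod_Iio_eq_prod_ite]
    refine Finset.prod_congr rfl fun j _ => ?_
    rcases lt_trichotomy j a with hj | hj | hj
    · have h2 : (j : ℕ) < a := hj
      cases h' : y j <;> simp [h2, hj, hj.ne, h', sigmaZ, Matrix.single]
    · subst hj
      simp [sigmaPlus, h1, Matrix.single]
    · have h2 : ¬ (j : ℕ) < a := not_lt.2 hj.le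
      have h3 : ¬ (j : ℕ) = a := fun h => hj.ne' (Fin.ext h)
      have h4 : ¬ j < a := h2
      rw [if_neg (by omega), if_neg (by omega), if_neg h4, Function.update_of_ne hj.ne',
        Matrix.one_apply_eq]
  · by_cases h0 : y a = false ∧ x a = true
    · obtain ⟨j, hj⟩ : ∃ j, x j ≠ Function.update y a true j := by
        by_contra! h'
        exact h ⟨h0.1, funext h'⟩
      have hja : j ≠ a := by
        rintro rfl
        simp [h0.2] at hj
      rw [Function.update_of_ne hja] at hj
      refine Finset.prod_eq_zero (Finset.mem_univ j) ?_
      have h3 : ¬ (j : ℕ) = a := fun h => hja (Fin.ext h)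
      have hz : sigmaZ (x j) (y j) = 0 := by
        cases hx : x j <;> cases hy : y j <;> simp_all [sigmaZ, Matrix.single]
      by_cases h2 : (j : ℕ) < a <;> simp [h2, h3, hz, Matrix.one_apply_ne hj]
    · refine Finset.prod_eq_zero (Finset.mem_univ a) ?_
      cases hx : x a <;> cases hy : y a <;> simp_all [sigmaPlus, Matrix.single]

lemma sum_psiStar_mul_left (r : ℤ) (y : Fin n → Spin) (F : (Fin n → Spin) → ℂ) :
    ∑ x, psiStar r n (r + (a : ℕ)) x y * F x =
      if y a = false then stringSign y a * F (Function.update y a true) else 0 := by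
  simp only [psiStar_apply]
  split_ifs with h <;> simp [h]

lemma sum_psiStar_mul_right (r : ℤ) (x : Fin n → Spin) (F : (Fin n → Spin) → ℂ) :
    ∑ y, psiStar r n (r + (a : ℕ)) x y * F y =
      if x a = true then stringSign x a * F (Function.update x a false) else 0 := by
  simp only [psiStar_apply]
  split_ifs with h
  · rw [Finset.sum_eq_single (Function.update x a false)]
    · have : stringSign (Function.update x a false) a = stringSign x a := by
        refine Finset.prod_congr rfl fun j hj => ?_
        rw [Function.update_of_ne (Finset.mem_Iio.1 hj).ne]
      rw [if_pos ⟨by simp, by simp [← h]⟩, this]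
    · intro y _ hy
      rw [if_neg, zero_mul]
      rintro ⟨h1, rfl⟩
      exact hy (by simp [← h1])
    · simp
  · refine Finset.sum_eq_zero fun y _ => ?_
    rw [if_neg, zero_mul]
    rintro ⟨h1, rfl⟩
    simp at h

end positions

/-- The relation between left and right multiplication by `ψ*` under a functional given by
minors. -/
lemma sum_minorFunctional_psiStar {n : ℕ} (κ : ℂ) (W : Fin (n + n) → Fin n → ℂ) (r : ℤ)
    (X : Op n) (b : Fin n) :
    ∑ a : Fin n, (W (Fin.castAdd n a) b * minorFunctional κ W (psiStar r n (r + (a : ℕ)) * X) +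
      (-1) ^ (n + (a : ℕ)) * W (Fin.natAdd n a.rev) b *
        minorFunctional κ W (X * psiStar r n (r + (a : ℕ)))) = 0 := by
  have hl : ∀ a : Fin n, minorFunctional κ W (psiStar r n (r + (a : ℕ)) * X) =
      ∑ η, ∑ ε, X η ε * (if η a = false then stringSign η a *
        minorAmplitude κ W ((plusPositions η ε).erase (Fin.castAdd n a)) else 0) := by
    intro a
    simp only [← plusPositions_update_left]
    have h := fun η ε => sum_psiStar_mul_left a r η fun x =>
      minorAmplitude κ W (plusPositions x ε)
    simp only [← h, minorFunctional, Matrix.mul_apply, Finset.sum_mul, Finset.mul_sum]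
    rw [Finset.sum_comm]
    conv_rhs => rw [Finset.sum_comm]
    refine Finset.sum_congr rfl fun ε _ => ?_
    rw [Finset.sum_comm]
    refine Finset.sum_congr rfl fun η _ => Finset.sum_congr rfl fun x _ => ?_
    ring
  have hr : ∀ a : Fin n, minorFunctional κ W (X * psiStar r n (r + (a : ℕ))) =
      ∑ η, ∑ ε, X η ε * (if ε a = true then stringSign ε a *
        minorAmplitude κ W ((plusPositions η ε).erase (Fin.natAdd n a.rev)) else 0) := by
    intro a
    simp only [← plusPositions_update_right]
    have h := fun η ε => sum_psiStar_mul_right a r ε fun x =>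
      minorAmplitude κ W (plusPositions η x)
    simp only [← h, minorFunctional, Matrix.mul_apply, Finset.sum_mul, Finset.mul_sum]
    refine Finset.sum_congr rfl fun x _ => ?_
    rw [Finset.sum_comm]
    simp only [mul_assoc]
  have key : ∀ η ε : Fin n → Spin, ∑ a : Fin n, (W (Fin.castAdd n a) b *
      (if η a = false then stringSign η a *
        minorAmplitude κ W ((plusPositions η ε).erase (Fin.castAdd n a)) else 0) +
      (-1) ^ (n + (a : ℕ)) * W (Fin.natAdd n a.rev) b * (if ε a = true then stringSign ε a *
        minorAmplitude κ W ((plusPositions η ε).erase (Fin.natAdd n a.rev)) else 0)) = 0 := by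
    intro η ε
    have h := sum_minorAmplitude_erase κ W (plusPositions η ε) b
    have hQ : ∀ F : Fin (n + n) → ℂ, ∑ p ∈ plusPositions η ε, F p =
        ∑ p, if p ∈ plusPositions η ε then F p else 0 := by
      intro F
      rw [← Finset.sum_filter]
      congr 1
      ext; simp
    rw [hQ, Fin.sum_univ_add] at h
    rw [Finset.sum_add_distrib]
    refine Eq.trans (congrArg₂ (· + ·) ?_ ?_) h
    · refine Finset.sum_congr rfl fun a _ => ?_
      simp only [castAdd_mem_plusPositions, neg_one_pow_card_filter_lt_castAdd]
      split_ifs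
      · ring
      · ring
    · refine Eq.trans ?_ (Equiv.sum_comp (Fin.revPerm : Equiv.Perm (Fin n)) _)
      refine Finset.sum_congr rfl fun a _ => ?_
      simp only [Fin.revPerm_apply, natAdd_mem_plusPositions, Fin.rev_rev]
      split_ifs with hε
      -- The sign formula needs exactly n + 1 positions; otherwise the amplitude of the erased set
      -- is zero by definition.
      · by_cases hc : (plusPositions η ε).card = n + 1
        · rw [neg_one_pow_card_filter_lt_natAdd η ε a hc hε]
          ring
        · have : ¬ ((plusPositions η ε).erase (Fin.natAdd n a.rev)).card = n := by
            have hm : Fin.natAdd n a.rev ∈ plusPositions η ε :=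
              (natAdd_mem_plusPositions _ _ _).2 (by rw [Fin.rev_rev, hε])
            rw [Finset.card_erase_of_mem hm]
            have := Finset.card_pos.2 ⟨_, hm⟩
            omega
          rw [minorAmplitude, dif_neg this]
          ring
      · ring
  simp only [hl, hr, Finset.mul_sum, ← Finset.sum_add_distrib]
  rw [Finset.sum_comm]
  refine Finset.sum_eq_zero fun η _ => ?_
  rw [Finset.sum_comm]
  refine Finset.sum_eq_zero fun ε _ => ?_
  refine Eq.trans ?_ (mul_eq_zero_of_right (X η ε) (key η ε))
  rw [Finset.mul_sum]
  refine Finset.sum_congr rfl fun a _ => ?_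
  ring

/-! ### The value of a minor functional at the identity -/

section normalization

variable {n : ℕ} (ε : Fin n → Spin)

/-- The element of `plusPositions ε ε` at the site `a`. -/
def diagonalPosition (a : Fin n) : Fin (n + n) :=
  if ε a then Fin.natAdd n a.rev else Fin.castAdd n a

lemma diagonalPosition_mem (a : Fin n) : diagonalPosition ε a ∈ plusPositions ε ε := by
  cases h : ε a
  · simp [diagonalPosition, h, castAdd_mem_plusPositions]
  · rw [diagonalPosition, h, if_pos rfl, natAdd_mem_plusPositions, Fin.rev_rev, h]

/-- A spin - puts site `a` in the first half, before everything over later sites; a spin + puts it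
in the reversed second half, after everything over later sites. The spin at `b` is therefore
irrelevant. -/
lemma diagonalPosition_lt_iff {a b : Fin n} (hab : a < b) :
    diagonalPosition ε a < diagonalPosition ε b ↔ ε a = false := by
  have := a.2
  have := b.2
  have hab' : (a : ℕ) < b := hab
  cases ha : ε a <;> cases hb : ε b <;>
    simp only [diagonalPosition, ha, hb, if_true, if_false, Fin.lt_def, Fin.val_natAdd,
      Fin.val_castAdd, Fin.val_rev, Bool.false_eq_true, iff_true, iff_false, reduceCtorEq] <;> omega

lemma diagonalPosition_injective : Function.Injective (diagonalPosition ε) := by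
  intro a b h
  have ha := a.2
  have hb := b.2
  rw [Fin.ext_iff] at h ⊢
  cases ha' : ε a <;> cases hb' : ε b <;>
    simp only [diagonalPosition, ha', hb', if_true, if_false, Fin.val_natAdd,
      Fin.val_castAdd, Fin.val_rev, Bool.false_eq_true] at h <;> omega

lemma image_diagonalPosition : Finset.univ.image (diagonalPosition ε) = plusPositions ε ε := by
  ext p
  constructor
  · intro h
    obtain ⟨a, -, rfl⟩ := Finset.mem_image.1 h
    exact diagonalPosition_mem ε a
  · refine Fin.addCases (fun j h => ?_) (fun j h => ?_) p
    · rw [castAdd_mem_plusPositions] at h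
      exact Finset.mem_image.2 ⟨j, Finset.mem_univ _, by simp [diagonalPosition, h]⟩
    · rw [natAdd_mem_plusPositions] at h
      exact Finset.mem_image.2 ⟨j.rev, Finset.mem_univ _, by
        rw [diagonalPosition, if_pos h, Fin.rev_rev]⟩

lemma card_plusPositions_self : (plusPositions ε ε).card = n := by
  rw [← image_diagonalPosition, Finset.card_image_of_injective _ (diagonalPosition_injective ε)]
  simp

/-- The rows are reordered from positions to sites. Each site `a` with spin + is inverted with all n
- 1 - a later sites and no other inversions occur, which gives the sign row by row. -/
lemma minorAmplitude_diagonal (κ : ℂ) (W : Fin (n + n) → Fin n → ℂ) :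
    minorAmplitude κ W (plusPositions ε ε) =
      κ * Matrix.det (Matrix.of fun a b : Fin n =>
        if ε a then (-1) ^ (n + (a : ℕ) + 1) * W (Fin.natAdd n a.rev) b
        else W (Fin.castAdd n a) b) := by
  have hc := card_plusPositions_self ε
  let e := (plusPositions ε ε).orderIsoOfFin hc
  let σ : Equiv.Perm (Fin n) := Equiv.ofBijective
    (fun a => e.symm ⟨diagonalPosition ε a, diagonalPosition_mem ε a⟩)
    (Finite.injective_iff_bijective.1 fun a b h => diagonalPosition_injective ε
      (congrArg Subtype.val (e.symm.injective h)))
  have hσ : ∀ a, (plusPositions ε ε).orderEmbOfFin hc (σ a) = diagonalPosition ε a := by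
    intro a
    rw [← Finset.coe_orderIsoOfFin_apply]
    exact congrArg Subtype.val (e.apply_symm_apply _)
  have hsign : ((Equiv.Perm.sign σ : ℤ) : ℂ) =
      ∏ a : Fin n, if ε a then (-1) ^ (n + (a : ℕ) + 1) else 1 := by
    rw [Equiv.Perm.sign_eq_prod_prod_Ioi]
    push_cast
    refine Finset.prod_congr rfl fun a _ => ?_
    have : ∀ b ∈ Finset.Ioi a, (((if σ a < σ b then 1 else -1 : ℤˣ) : ℤ) : ℂ) =
        if ε a then -1 else 1 := by
      intro b hb
      have h : σ a < σ b ↔ ε a = false := by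
        rw [← diagonalPosition_lt_iff ε (Finset.mem_Ioi.1 hb), ← hσ a, ← hσ b]
        exact ((plusPositions ε ε).orderEmbOfFin hc).lt_iff_lt.symm
      cases h' : ε a <;> simp [h, h']
    rw [Finset.prod_congr rfl this, Finset.prod_const, Fin.card_Ioi]
    split_ifs
    · have := a.2
      obtain ⟨k, hk⟩ : ∃ k, n = a + 1 + k := ⟨n - (a + 1), by omega⟩
      have h1 : n - 1 - (a : ℕ) = k := by omega
      -- The exponents n - 1 - a and n + a + 1 have the same parity.
      have h2 : n + (a : ℕ) + 1 = k + 2 * (a + 1) := by omega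
      rw [h1, h2, pow_add (-1 : ℂ) k, pow_mul]
      simp
    · simp
  have hdet := Matrix.det_permute σ
    (Matrix.of fun l b => W ((plusPositions ε ε).orderEmbOfFin hc l) b)
  have hss : ((Equiv.Perm.sign σ : ℤ) : ℂ) * ((Equiv.Perm.sign σ : ℤ) : ℂ) = 1 := by
    rw [← Int.cast_mul, ← Units.val_mul, Int.units_mul_self]
    simp
  have hmat : (Matrix.of fun a b : Fin n =>
        if ε a then (-1) ^ (n + (a : ℕ) + 1) * W (Fin.natAdd n a.rev) b
        else W (Fin.castAdd n a) b) = Matrix.of fun a b =>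
        (if ε a then (-1) ^ (n + (a : ℕ) + 1) else 1) *
          (Matrix.of fun l b => W ((plusPositions ε ε).orderEmbOfFin hc l) b).submatrix σ id a b := by
    ext a b
    simp only [Matrix.of_apply, Matrix.submatrix_apply, hσ, diagonalPosition, id]
    split_ifs <;> simp
  rw [minorAmplitude, dif_pos hc, hmat, Matrix.det_mul_column, ← hsign, hdet, ← mul_assoc _ _
    (Matrix.det _), hss, one_mul]

end normalization

/-- The value at the identity of a functional given by minors. -/
lemma minorFunctional_one {n : ℕ} (κ : ℂ) (W : Fin (n + n) → Fin n → ℂ) :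
    minorFunctional κ W 1 = κ * Matrix.det (Matrix.of fun a b : Fin n =>
      W (Fin.castAdd n a) b - (-1) ^ (n + (a : ℕ)) * W (Fin.natAdd n a.rev) b) := by
  -- Each row is a sum of two vectors indexed by `Bool`, so multilinearity expands the determinant
  -- into a sum over spin configurations. These are the diagonal matrix units, the only ones
  -- occurring in the identity.
  have h := (Matrix.detRowAlternating (n := Fin n) (R := ℂ)).map_sum
    (α := fun _ => Bool) (fun (a : Fin n) (s : Bool) (b : Fin n) =>
      if s then (-1) ^ (n + (a : ℕ) + 1) * W (Fin.natAdd n a.rev) b else W (Fin.castAdd n a) b)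
  have hL : (Matrix.of fun a b : Fin n =>
      W (Fin.castAdd n a) b - (-1) ^ (n + (a : ℕ)) * W (Fin.natAdd n a.rev) b) =
      fun a : Fin n => ∑ s : Bool, fun b : Fin n =>
      if s then (-1) ^ (n + (a : ℕ) + 1) * W (Fin.natAdd n a.rev) b else W (Fin.castAdd n a) b := by
    ext a b
    simp [pow_succ]
    ring
  rw [hL]
  refine Eq.trans ?_ (congrArg (κ * ·) h.symm)
  simp only [minorFunctional, Finset.mul_sum]
  refine Finset.sum_congr rfl fun ε _ => ?_
  rw [Finset.sum_eq_single ε]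
  · rw [Matrix.one_apply_eq, one_mul, minorAmplitude_diagonal]
    rfl
  · intro ε' _ h
    rw [Matrix.one_apply_ne h.symm, zero_mul]
  · simp

/-! ### Wick recursion -/

lemma isLinearMap_minorFunctional {n : ℕ} (κ : ℂ) (W : Fin (n + n) → Fin n → ℂ) :
    IsLinearMap ℂ (minorFunctional κ W) where
  map_add X Y := by
    simp only [minorFunctional, Matrix.add_apply, add_mul, Finset.sum_add_distrib]
  map_smul c X := by
    simp only [minorFunctional, Matrix.smul_apply, smul_eq_mul, mul_assoc, Finset.mul_sum]

lemma fermionMonomial_succ (r : ℤ) (n : ℕ) {k : ℕ} (m l : Fin (k + 1) → ℤ) :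
    fermionMonomial r n m l = (List.ofFn fun j => psi r n (m j)).prod *
      (List.ofFn fun i : Fin k => psiStar r n (l i.rev.succ)).prod * psiStar r n (l 0) := by
  rw [fermionMonomial, List.ofFn_succ' (fun i => psiStar r n (l i.rev)), List.concat_eq_append,
    List.prod_append, ← mul_assoc]
  simp [Fin.rev_castSucc]

/-- The anticommutator of `ψ*_a` with a product of `k + 1` operators `ψ` and `k` operators `ψ*`. -/
lemma psiStar_anticomm_monomial {r : ℤ} {n k : ℕ} {a : ℤ} (ha : a ∈ Set.Ico r (r + n))
    {m : Fin (k + 1) → ℤ} {l : Fin k → ℤ} (hm : ∀ j, m j ∈ Set.Ico r (r + n))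
    (hl : ∀ j, l j ∈ Set.Ico r (r + n)) :
    psiStar r n a * ((List.ofFn fun j => psi r n (m j)).prod *
      (List.ofFn fun i : Fin k => psiStar r n (l i.rev)).prod) +
    (List.ofFn fun j => psi r n (m j)).prod *
      (List.ofFn fun i : Fin k => psiStar r n (l i.rev)).prod * psiStar r n a =
    ∑ j : Fin (k + 1), ((-1) ^ (j : ℕ) * (if a = m j then 1 else 0 : ℂ)) •
      fermionMonomial r n (fun i => m (j.succAbove i)) l := by
  have h1 := mul_prod_ofFn_of_anticomm_scalar (psiStar r n a) (fun j => psi r n (m j))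
    (fun j => if a = m j then 1 else 0) fun i => by
      rw [psiStar_anticomm_psi ha (hm i)]
      split_ifs <;> simp
  have h2 := mul_prod_ofFn_of_anticomm (psiStar r n a) (fun j => psiStar r n (l j.rev))
    fun i => psiStar_anticomm_psiStar ha (hl i.rev)
  -- The monomial has 2k + 1 factors, an odd number, so moving ψ*_a through all of it yields an
  -- anticommutator.
  have h3 : ((-1 : Op n) ^ (k + 1)) * (-1) ^ k = -1 := by
    rw [← pow_add, show k + 1 + k = 2 * k + 1 by ring, pow_succ, pow_mul]
    simp
  have h4 : ∀ (P Q : Op n), (-1) ^ (k + 1) * (P * ((-1) ^ k * Q)) = - (P * Q) := by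
    intro P Q
    rw [← mul_assoc P, ← ((Commute.neg_one_left P).pow_left k).eq, ← mul_assoc, ← mul_assoc, h3]
    simp
  rw [← mul_assoc, h1, add_mul, Finset.sum_mul, mul_assoc ((-1) ^ (k + 1)),
    mul_assoc _ (psiStar r n a), h2, h4, mul_assoc, neg_add_cancel_right]
  simp only [fermionMonomial, smul_mul_assoc]

/-- Wick's theorem for a functional given by minors of two matrices whose difference is
diagonal. -/
lemma minorFunctional_fermionMonomial {n : ℕ} {κ : ℂ} {W : Fin (n + n) → Fin n → ℂ}
    {K : Fin n → Fin n → ℂ} {u : Fin n → ℂ} {d : ℂ} {r : ℤ} {G : ℤ → ℤ → ℂ}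
    (hu : ∀ a, u a ≠ 0) (hd : d ≠ 0)
    (hW : ∀ a b, W (Fin.castAdd n a) b = u a * K a b)
    (hW' : ∀ a b : Fin n, (-1) ^ (n + (a : ℕ)) * W (Fin.natAdd n a.rev) b =
      u a * (K a b + if a = b then d else 0))
    (hG : ∀ a b : Fin n, G (r + (a : ℕ)) (r + (b : ℕ)) = -(u a * K a b) / (u b * d))
    {k : ℕ} {m l : Fin k → ℤ} (hm : ∀ j, m j ∈ Set.Ico r (r + n))
    (hl : ∀ j, l j ∈ Set.Ico r (r + n)) :
    minorFunctional κ W (fermionMonomial r n m l) =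
      minorFunctional κ W 1 * Matrix.det (Matrix.of fun j i => G (m j) (l i)) := by
  induction k with
  | zero => simp [fermionMonomial]
  | succ k ih =>
    set ω := (isLinearMap_minorFunctional κ W).mk' with hω
    have hωe : ∀ X, minorFunctional κ W X = ω X := fun _ => rfl
    set X : Op n := (List.ofFn fun j => psi r n (m j)).prod *
      (List.ofFn fun i : Fin k => psiStar r n (l i.rev.succ)).prod with hX
    obtain ⟨b, hb⟩ : ∃ b : Fin n, l 0 = r + (b : ℕ) :=
      ⟨⟨(l 0 - r).toNat, by have := (hl 0).1; have := (hl 0).2; omega⟩, by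
        have := (hl 0).1; simp only []; omega⟩
    have hrel := sum_minorFunctional_psiStar κ W r X b
    have hanti : ∀ a : Fin n, ω (psiStar r n (r + (a : ℕ)) * X) +
        ω (X * psiStar r n (r + (a : ℕ))) = ∑ j : Fin (k + 1),
        ((-1) ^ (j : ℕ) * (if r + ((a : ℕ) : ℤ) = m j then 1 else 0 : ℂ)) *
          ω (fermionMonomial r n (fun i => m (j.succAbove i)) fun i => l i.succ) := by
      intro a
      have ha : r + ((a : ℕ) : ℤ) ∈ Set.Ico r (r + n) := by
        have := a.2
        constructor <;> omega
      rw [← map_add, hX, psiStar_anticomm_monomial ha hm (l := fun i => l i.succ)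
        (fun j => hl j.succ), map_sum]
      simp only [map_smul, smul_eq_mul]
    -- The part of the two rows common to both halves multiplies the anticommutator; the diagonal
    -- difference `d` isolates the single term `X ψ*_b`.
    have hrel' : ∑ a : Fin n, u a * K a b * (ω (psiStar r n (r + (a : ℕ)) * X) +
        ω (X * psiStar r n (r + (a : ℕ)))) + u b * d * ω (X * psiStar r n (r + (b : ℕ))) = 0 := by
      rw [← hrel]
      have : u b * d * ω (X * psiStar r n (r + (b : ℕ))) =
          ∑ a : Fin n, u a * (if a = b then d else 0) * ω (X * psiStar r n (r + (a : ℕ))) := by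
        simp
      rw [this, ← Finset.sum_add_distrib]
      refine Finset.sum_congr rfl fun a _ => ?_
      rw [hW, hW', ← hωe, ← hωe]
      ring
    have hsum : ∑ a : Fin n, u a * K a b * (ω (psiStar r n (r + (a : ℕ)) * X) +
        ω (X * psiStar r n (r + (a : ℕ)))) = -(u b * d) * ∑ j : Fin (k + 1), (-1) ^ (j : ℕ) *
          G (m j) (l 0) *
          ω (fermionMonomial r n (fun i => m (j.succAbove i)) fun i => l i.succ) := by
      simp only [hanti, Finset.mul_sum]
      rw [Finset.sum_comm]
      refine Finset.sum_congr rfl fun j _ => ?_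
      obtain ⟨a, ha⟩ : ∃ a : Fin n, m j = r + (a : ℕ) :=
        ⟨⟨(m j - r).toNat, by have := (hm j).1; have := (hm j).2; omega⟩, by
          have := (hm j).1; simp only []; omega⟩
      rw [Finset.sum_eq_single a]
      · rw [hb]
        simp only [ha, hG, if_true]
        have := hu b
        field_simp
      · intro a' _ h
        have : ¬ r + ((a' : ℕ) : ℤ) = m j := by
          rw [ha]
          intro h'
          exact h (Fin.ext (by omega))
        simp [this]
      · simp
    have hub : u b * d ≠ 0 := mul_ne_zero (hu b) hd
    have hfin : ω (X * psiStar r n (r + (b : ℕ))) = ∑ j : Fin (k + 1), (-1) ^ (j : ℕ) *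
          G (m j) (l 0) *
          ω (fermionMonomial r n (fun i => m (j.succAbove i)) fun i => l i.succ) := by
      rw [hsum] at hrel'
      apply mul_left_cancel₀ hub
      linear_combination hrel'
    rw [fermionMonomial_succ, ← hX, hb, hωe, hfin, Matrix.det_succ_column_zero, Finset.mul_sum]
    refine Finset.sum_congr rfl fun j _ => ?_
    rw [← hωe, ih (fun i => hm _) (fun i => hl _)]
    have : (Matrix.of fun j i => G (m j) (l i)).submatrix j.succAbove Fin.succ =
        Matrix.of fun j' i => G (m (j.succAbove j')) (l (Fin.succ i)) := rfl
    rw [this, Matrix.of_apply]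
    ring

/-! ### The determinant behind the integrand -/

section polynomials

open Polynomial

/-- The polynomial `∏_{j < b} (X + v_j) ∏_{j > b} (X - v_j)`. -/
noncomputable def mixedPolynomial {A : Type*} [CommRing A] {n : ℕ} (v : Fin n → A) (b : Fin n) :
    A[X] :=
  (∏ j ∈ Finset.Iio b, (X + C (v j))) * ∏ j ∈ Finset.Ioi b, (X - C (v j))

lemma natDegree_mixedPolynomial_lt {A : Type*} [CommRing A] {n : ℕ} (v : Fin n → A) (b : Fin n) :
    (mixedPolynomial v b).natDegree < n := by
  have h1 : (∏ j ∈ Finset.Iio b, (X + C (v j))).natDegree ≤ (b : ℕ) := by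
    refine (natDegree_prod_le _ _).trans ((Finset.sum_le_card_nsmul _ _ 1 fun j _ => ?_).trans ?_)
    · compute_degree
    · simp
  have h2 : (∏ j ∈ Finset.Ioi b, (X - C (v j))).natDegree ≤ n - 1 - b := by
    refine (natDegree_prod_le _ _).trans ((Finset.sum_le_card_nsmul _ _ 1 fun j _ => ?_).trans ?_)
    · compute_degree
    · simp
  have := natDegree_mul_le (p := ∏ j ∈ Finset.Iio b, (X + C (v j)))
    (q := ∏ j ∈ Finset.Ioi b, (X - C (v j)))
  have := b.2
  unfold mixedPolynomial
  omega

lemma eval_mixedPolynomial {A : Type*} [CommRing A] {n : ℕ} (v : Fin n → A) (b : Fin n) (x : A) :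
    (mixedPolynomial v b).eval x =
      (∏ j ∈ Finset.Iio b, (x + v j)) * ∏ j ∈ Finset.Ioi b, (x - v j) := by
  simp [mixedPolynomial, eval_prod]

/-- The degrees are below n, so evaluation at the points is the Vandermonde matrix times the
coefficient matrix. -/
lemma det_eval_mixedPolynomial {A : Type*} [CommRing A] {n : ℕ} (u v : Fin n → A) :
    Matrix.det (Matrix.of fun l b => (mixedPolynomial v b).eval (u l)) =
      (Matrix.vandermonde u).det *
        Matrix.det (Matrix.of fun i b : Fin n => (mixedPolynomial v b).coeff i) := by
  rw [← Matrix.det_mul]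
  congr 1
  ext l b
  rw [Matrix.of_apply, eval_eq_sum_range' (natDegree_mixedPolynomial_lt v b), Matrix.mul_apply,
    Finset.sum_range]
  refine Finset.sum_congr rfl fun i _ => ?_
  rw [Matrix.vandermonde_apply, Matrix.of_apply, mul_comm]

lemma prod_prod_Ioi_comm {A : Type*} [CommMonoid A] {n : ℕ} (F : Fin n → Fin n → A) :
    ∏ j, ∏ k ∈ Finset.Ioi j, F j k = ∏ k, ∏ j ∈ Finset.Iio k, F j k :=
  Finset.prod_comm' (by simp)

/-- Evaluation at the nodes `v` themselves gives a triangular matrix, since for l > b the factor x -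
v_l vanishes at v_l. Its diagonal product is divided by the Vandermonde determinant, nonzero for
distinct nodes. -/
lemma det_coeff_mixedPolynomial_of_injective {A : Type*} [CommRing A] [IsDomain A] {n : ℕ}
    {v : Fin n → A} (hv : Function.Injective v) :
    Matrix.det (Matrix.of fun i b : Fin n => (mixedPolynomial v b).coeff i) =
      (∏ j : Fin n, ∏ _k ∈ Finset.Ioi j, -1) * ∏ j, ∏ k ∈ Finset.Ioi j, (v j + v k) := by
  have h0 : (Matrix.vandermonde v).det ≠ 0 := Matrix.det_vandermonde_ne_zero_iff.2 hv
  apply mul_left_cancel₀ h0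
  rw [← det_eval_mixedPolynomial, Matrix.det_of_isUpperTriangular]
  · simp only [Matrix.of_apply, eval_mixedPolynomial, Matrix.det_vandermonde]
    have h1 : ∏ b : Fin n, ∏ j ∈ Finset.Iio b, (v b + v j) =
        ∏ j, ∏ k ∈ Finset.Ioi j, (v j + v k) := by
      simp only [prod_prod_Ioi_comm, add_comm]
    have h2 : ∏ b : Fin n, ∏ j ∈ Finset.Ioi b, (v b - v j) =
        (∏ b : Fin n, ∏ j ∈ Finset.Ioi b, (v j - v b)) *
          ∏ j : Fin n, ∏ _k ∈ Finset.Ioi j, -1 := by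
      simp only [← Finset.prod_mul_distrib]
      refine Finset.prod_congr rfl fun b _ => Finset.prod_congr rfl fun j _ => ?_
      ring
    rw [Finset.prod_mul_distrib, h1, h2]
    ring
  · intro l b h
    rw [Matrix.of_apply, eval_mixedPolynomial]
    apply mul_eq_zero_of_right
    exact Finset.prod_eq_zero (Finset.mem_Ioi.2 h) (sub_self _)

lemma det_coeff_mixedPolynomial {n : ℕ} (v : Fin n → ℂ) :
    Matrix.det (Matrix.of fun i b : Fin n => (mixedPolynomial v b).coeff i) =
      (∏ j : Fin n, ∏ _k ∈ Finset.Ioi j, -1) * ∏ j, ∏ k ∈ Finset.Ioi j, (v j + v k) := by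
  -- Coinciding nodes are covered by proving the identity for indeterminates and specializing.
  have h := congrArg (MvPolynomial.eval v) (det_coeff_mixedPolynomial_of_injective
    (MvPolynomial.X_injective (R := ℂ) (σ := Fin n)))
  rw [RingHom.map_det] at h
  convert h using 2
  · ext i b
    have : mixedPolynomial v b =
        (mixedPolynomial (MvPolynomial.X (R := ℂ)) b).map (MvPolynomial.eval v) := by
      simp [mixedPolynomial, Polynomial.map_prod]
    simp [this, coeff_map]
  · simp

end polynomials

/-- The determinant of the functions `∏_{j < b} (u + v_j) ∏_{j > b} (u - v_j)` at points `u_l`. -/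
lemma det_mixedProd {n : ℕ} (u v : Fin n → ℂ) :
    Matrix.det (Matrix.of fun l b : Fin n =>
      (∏ j ∈ Finset.Iio b, (u l + v j)) * ∏ j ∈ Finset.Ioi b, (u l - v j)) =
      (∏ l, ∏ l' ∈ Finset.Ioi l, (u l - u l')) * ∏ j, ∏ k ∈ Finset.Ioi j, (v j + v k) := by
  have h := det_eval_mixedPolynomial u v
  simp only [eval_mixedPolynomial] at h
  rw [h, det_coeff_mixedPolynomial, Matrix.det_vandermonde, ← mul_assoc,
    ← Finset.prod_mul_distrib]
  congr 1
  refine Finset.prod_congr rfl fun b _ => ?_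
  rw [← Finset.prod_mul_distrib]
  refine Finset.prod_congr rfl fun j _ => ?_
  ring

lemma prod_prod_Ioi_mul {n : ℕ} (f : Fin n → ℂ) :
    ∏ j, ∏ k ∈ Finset.Ioi j, (f j * f k) =
      ∏ j, ((∏ k ∈ Finset.Iio j, f k) * ∏ k ∈ Finset.Ioi j, f k) := by
  simp only [Finset.prod_mul_distrib]
  rw [prod_prod_Ioi_comm]

lemma prod_prod_Ioi_mul_eq_pow {n : ℕ} (f : Fin n → ℂ) :
    ∏ j, ∏ k ∈ Finset.Ioi j, (f j * f k) =
      ∏ j, ((∏ _k ∈ Finset.Iio j, f j) * ∏ _k ∈ Finset.Ioi j, f j) := by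
  simp only [Finset.prod_mul_distrib]
  rw [prod_prod_Ioi_comm fun _ k => f k, mul_comm]

lemma two_mul_cosh_half_sub (x y : ℂ) :
    2 * cosh ((x - y) / 2) = exp (-x / 2) * exp (-y / 2) * (exp x + exp y) := by
  rw [cosh, mul_add, ← exp_add, ← exp_add, ← exp_add, mul_div_cancel₀ _ two_ne_zero]
  ring_nf

lemma two_mul_sinh_half_sub (x y : ℂ) :
    2 * sinh ((x - y) / 2) = exp (-x / 2) * exp (-y / 2) * (exp x - exp y) := by
  rw [sinh, mul_sub, ← exp_add, ← exp_add, ← exp_add, mul_div_cancel₀ _ two_ne_zero]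
  ring_nf

/-- The function `∏_{j < b} 2 cosh ((z - β_j) / 2) ∏_{j > b} 2 sinh ((z - β_j) / 2)`. -/
noncomputable def columnFun {n : ℕ} (β : Fin n → ℂ) (b : Fin n) (z : ℂ) : ℂ :=
  (∏ j ∈ Finset.Iio b, 2 * cosh ((z - β j) / 2)) * ∏ j ∈ Finset.Ioi b, 2 * sinh ((z - β j) / 2)

/-- With u = exp α and v = exp β this is `det_mixedProd`: every entry has n - 1 hyperbolic factors,
whose half exponentials split into a row factor and a column factor. -/
lemma det_columnFun {n : ℕ} (α β : Fin n → ℂ) :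
    Matrix.det (Matrix.of fun l b : Fin n => columnFun β b (α l)) =
      (∏ l, ∏ l' ∈ Finset.Ioi l, 2 * sinh ((α l - α l') / 2)) *
        ∏ j, ∏ k ∈ Finset.Ioi j, 2 * cosh ((β j - β k) / 2) := by
  have key := det_mixedProd (fun l => exp (α l)) (fun j => exp (β j))
  set E : Fin n → ℂ := fun l => exp (-α l / 2) with hE
  set F : Fin n → ℂ := fun l => exp (-β l / 2) with hF
  have hmat : (Matrix.of fun l b : Fin n => columnFun β b (α l)) = Matrix.of fun l b =>
      (E l ^ (n - 1)) * (Matrix.of fun l b : Fin n =>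
        ((∏ k ∈ Finset.Iio b, F k) * ∏ k ∈ Finset.Ioi b, F k) * (Matrix.of fun l b : Fin n =>
      (∏ j ∈ Finset.Iio b, (exp (α l) + exp (β j))) *
        ∏ j ∈ Finset.Ioi b, (exp (α l) - exp (β j))) l b) l b := by
    ext l b
    have hp : E l ^ (n - 1) = E l ^ (b : ℕ) * E l ^ (n - 1 - b) := by
      rw [← pow_add]
      congr 1
      have := b.2
      omega
    simp only [Matrix.of_apply, columnFun, two_mul_cosh_half_sub, two_mul_sinh_half_sub,
      Finset.prod_mul_distrib, Finset.prod_const, Fin.card_Iio, Fin.card_Ioi, hp]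
    ring
  have hpow : ∏ l, E l ^ (n - 1) = ∏ l, ∏ l' ∈ Finset.Ioi l, (E l * E l') := by
    rw [prod_prod_Ioi_mul_eq_pow]
    refine Finset.prod_congr rfl fun l _ => ?_
    rw [Finset.prod_const, Finset.prod_const, Fin.card_Iio, Fin.card_Ioi, ← pow_add]
    congr 1
    have := l.2
    omega
  rw [hmat, Matrix.det_mul_column, Matrix.det_mul_row, key, hpow, ← prod_prod_Ioi_mul]
  simp only [two_mul_cosh_half_sub, two_mul_sinh_half_sub, Finset.prod_mul_distrib, hE, hF]
  ring

/-! ### Bounds for hyperbolic functions and contour shifts -/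

open Filter Topology

lemma integrable_exp_neg_abs : Integrable fun x : ℝ => Real.exp (-|x|) := by
  rw [← integrableOn_univ, ← Set.Iic_union_Ioi (a := (0 : ℝ))]
  refine IntegrableOn.union ?_ ?_
  · refine (integrableOn_exp_Iic 0).congr_fun (fun x hx => ?_) measurableSet_Iic
    simp only [abs_of_nonpos (Set.mem_Iic.1 hx), neg_neg]
  · refine (integrableOn_exp_neg_Ioi 0).congr_fun (fun x hx => ?_) measurableSet_Ioi
    simp only [abs_of_pos (Set.mem_Ioi.1 hx)]

lemma normSq_sinh (z : ℂ) : ‖sinh z‖ ^ 2 = Real.sinh z.re ^ 2 + Real.sin z.im ^ 2 := by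
  conv_lhs => rw [← re_add_im z]
  rw [sinh_add, cosh_mul_I, sinh_mul_I, ← ofReal_sinh, ← ofReal_cosh, ← ofReal_sin, ← ofReal_cos,
    ← normSq_eq_norm_sq, normSq_apply]
  simp only [add_re, add_im, mul_re, mul_im, ofReal_re, ofReal_im, I_re, I_im]
  have h1 := Real.cosh_sq z.re
  have h2 := Real.sin_sq_add_cos_sq z.im
  linear_combination Real.sin z.im ^ 2 * h1 + Real.sinh z.re ^ 2 * h2

lemma normSq_cosh (z : ℂ) : ‖cosh z‖ ^ 2 = Real.sinh z.re ^ 2 + Real.cos z.im ^ 2 := by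
  conv_lhs => rw [← re_add_im z]
  rw [cosh_add, cosh_mul_I, sinh_mul_I, ← ofReal_sinh, ← ofReal_cosh, ← ofReal_sin, ← ofReal_cos,
    ← normSq_eq_norm_sq, normSq_apply]
  simp only [add_re, add_im, mul_re, mul_im, ofReal_re, ofReal_im, I_re, I_im]
  have h1 := Real.cosh_sq z.re
  have h2 := Real.sin_sq_add_cos_sq z.im
  linear_combination Real.cos z.im ^ 2 * h1 + Real.sinh z.re ^ 2 * h2

lemma norm_cosh_le (z : ℂ) : ‖cosh z‖ ≤ Real.cosh z.re := by
  refine abs_le_of_sq_le_sq' ?_ (Real.cosh_pos _).le |>.2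
  rw [normSq_cosh, Real.cosh_sq]
  gcongr
  exact Real.cos_sq_le_one _

lemma le_norm_sinh (z : ℂ) : |Real.sin z.im| * Real.cosh z.re ≤ ‖sinh z‖ := by
  refine abs_le_of_sq_le_sq' ?_ (norm_nonneg _) |>.2
  rw [normSq_sinh, mul_pow, sq_abs, Real.cosh_sq]
  nlinarith [Real.sin_sq_le_one z.im, sq_nonneg (Real.sinh z.re)]

lemma sinh_ne_zero_of_sin_im_ne_zero {z : ℂ} (h : Real.sin z.im ≠ 0) : sinh z ≠ 0 := by
  intro h0
  have := le_norm_sinh z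
  rw [h0, norm_zero] at this
  exact absurd this (not_le.2 (mul_pos (abs_pos.2 h) (Real.cosh_pos _)))

lemma inv_cosh_sub_le (x b : ℝ) :
    (Real.cosh (x - b))⁻¹ ≤ 2 * Real.exp |b| * Real.exp (-|x|) := by
  rw [inv_le_iff_one_le_mul₀ (Real.cosh_pos _)]
  have h1 := Real.exp_abs_le (x - b)
  have h2 : Real.exp |x| ≤ Real.exp |b| * Real.exp |x - b| := by
    rw [← Real.exp_add]
    gcongr
    have := abs_sub_abs_le_abs_sub x b
    linarith
  have h3 : Real.exp (-|x|) * Real.exp |x| = 1 := by rw [← Real.exp_add]; simp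
  have h4 : Real.exp |x - b| ≤ 2 * Real.cosh (x - b) := by
    rw [Real.cosh_eq]; linarith
  calc (1 : ℝ) = Real.exp (-|x|) * Real.exp |x| := h3.symm
    _ ≤ Real.exp (-|x|) * (Real.exp |b| * (2 * Real.cosh (x - b))) := by gcongr; exact h2.trans (by gcongr)
    _ = _ := by ring

/-- Shifting the line of integration of a holomorphic function decaying exponentially in a
strip. -/
lemma integral_line_eq_of_differentiableOn {f : ℂ → ℂ} {y₁ y₂ M : ℝ} (hy : y₁ ≤ y₂)
    (hd : ∀ z : ℂ, z.im ∈ Set.Icc y₁ y₂ → DifferentiableAt ℂ f z)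
    (hb : ∀ z : ℂ, z.im ∈ Set.Icc y₁ y₂ → ‖f z‖ ≤ M * Real.exp (-|z.re|))
    (hi₁ : Integrable fun x : ℝ => f (x + y₁ * I)) (hi₂ : Integrable fun x : ℝ => f (x + y₂ * I)) :
    ∫ x : ℝ, f (x + y₁ * I) = ∫ x : ℝ, f (x + y₂ * I) := by
  have hrect : ∀ T : ℝ, (∫ x : ℝ in -T..T, f (x + y₁ * I)) - (∫ x : ℝ in -T..T, f (x + y₂ * I)) =
      I • (∫ y : ℝ in y₁..y₂, f (((-T : ℝ) : ℂ) + y * I)) -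
        I • ∫ y : ℝ in y₁..y₂, f ((T : ℂ) + y * I) := by
    intro T
    have h := integral_boundary_rect_eq_zero_of_differentiableOn f (((-T : ℝ) : ℂ) + y₁ * I)
      (T + y₂ * I) fun z hz => (hd z (by
        have := hz.2
        simpa [Set.uIcc_of_le hy] using this)).differentiableWithinAt
    simp only [add_re, add_im, mul_re, mul_im, ofReal_re, ofReal_im, I_re, I_im, mul_zero, mul_one,
      add_zero, zero_add, sub_zero] at h
    linear_combination h
  have hvert : ∀ s : ℝ → ℝ, (∀ T, |s T| = |T|) →
      Tendsto (fun T => ∫ y : ℝ in y₁..y₂, f ((s T : ℂ) + y * I)) atTop (𝓝 0) := by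
    intro s hs
    have h1 : Tendsto (fun T : ℝ => M * Real.exp (-|T|) * |y₂ - y₁|) atTop (𝓝 0) := by
      have : Tendsto (fun T : ℝ => M * Real.exp (-|T|) * |y₂ - y₁|) atTop
          (𝓝 (M * 0 * |y₂ - y₁|)) :=
        ((Real.tendsto_exp_neg_atTop_nhds_zero.comp tendsto_abs_atTop_atTop).const_mul
          M).mul_const _
      simpa using this
    refine squeeze_zero_norm (fun T => ?_) h1
    refine intervalIntegral.norm_integral_le_of_norm_le_const fun y hy' => ?_
    rw [Set.uIoc_of_le hy] at hy'
    have := hb ((s T : ℂ) + y * I) (by simpa using ⟨hy'.1.le, hy'.2⟩)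
    simpa [hs] using this
  have hL := ((intervalIntegral_tendsto_integral hi₁ tendsto_neg_atTop_atBot tendsto_id).sub
    (intervalIntegral_tendsto_integral hi₂ tendsto_neg_atTop_atBot tendsto_id))
  have hR := ((hvert (fun T => -T) fun T => abs_neg T).const_smul I).sub
    ((hvert id fun T => rfl).const_smul I)
  have := tendsto_nhds_unique (hL.congr fun T => hrect T) hR
  rw [smul_zero, sub_zero] at this
  exact sub_eq_zero.1 this

lemma integrable_line_of_norm_le {f : ℂ → ℂ} {y M : ℝ}
    (hd : ∀ z : ℂ, z.im = y → DifferentiableAt ℂ f z)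
    (hb : ∀ z : ℂ, z.im = y → ‖f z‖ ≤ M * Real.exp (-|z.re|)) :
    Integrable fun x : ℝ => f (x + y * I) := by
  refine (integrable_exp_neg_abs.const_mul M).mono' ?_ ?_
  · refine Continuous.aestronglyMeasurable ?_
    refine continuous_iff_continuousAt.2 fun x => ?_
    refine ContinuousAt.comp (f := fun x : ℝ => (x + y * I : ℂ))
      (hd _ (by simp)).continuousAt (by fun_prop)
  · exact Eventually.of_forall fun x => by simpa using hb (x + y * I) (by simp)

lemma integral_inv_cosh : ∫ x : ℝ, (Real.cosh x)⁻¹ = Real.pi := by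
  have hder : ∀ x : ℝ, HasDerivAt (fun x => 2 * Real.arctan (Real.exp x)) (Real.cosh x)⁻¹ x := by
    intro x
    refine ((Real.hasDerivAt_exp x).arctan.const_mul 2).congr_deriv ?_
    rw [Real.cosh_eq, Real.exp_neg]
    have := Real.exp_pos x
    field_simp
    ring
  have hint : Integrable fun x : ℝ => (Real.cosh x)⁻¹ := by
    refine (integrable_exp_neg_abs.const_mul 2).mono' ?_ (Eventually.of_forall fun x => ?_)
    · exact (Real.continuous_cosh.inv₀ fun x => (Real.cosh_pos x).ne').aestronglyMeasurable
    · rw [Real.norm_of_nonneg (inv_nonneg.2 (Real.cosh_pos x).le)]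
      simpa using inv_cosh_sub_le x 0
  have h1 : Tendsto (fun x => 2 * Real.arctan (Real.exp x)) atBot (𝓝 (2 * Real.arctan 0)) :=
    ((Real.continuous_arctan.tendsto 0).comp Real.tendsto_exp_atBot).const_mul 2
  have h2 : Tendsto (fun x => 2 * Real.arctan (Real.exp x)) atTop (𝓝 (2 * (Real.pi / 2))) :=
    ((tendsto_nhds_of_tendsto_nhdsWithin Real.tendsto_arctan_atTop).comp
      Real.tendsto_exp_atTop).const_mul 2
  rw [integral_of_hasDerivAt_of_tendsto hder hint h1 h2]
  simp
  ring

lemma exists_pos_le_sin {y₁ y₂ : ℝ} (h₁ : 0 < y₁) (h₂ : y₂ < Real.pi) :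
    ∃ δ : ℝ, 0 < δ ∧ ∀ y ∈ Set.Icc y₁ y₂, δ ≤ |Real.sin y| :=
  isCompact_Icc.exists_forall_le' (by fun_prop) fun y hy =>
    abs_pos.2 (Real.sin_pos_of_pos_of_lt_pi (h₁.trans_le hy.1) (hy.2.trans_lt h₂)).ne'

/-! ### One-variable kernels and their integrals over the two lines -/

/-- The function `2 sinh ((z - β_j) / 2)`. -/
noncomputable def siteSinh (β : ℤ → ℝ) (j : ℤ) (z : ℂ) : ℂ := 2 * sinh ((z - β j) / 2)

/-- The function `2 cosh ((z - β_j) / 2)`. -/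
noncomputable def siteCosh (β : ℤ → ℝ) (j : ℤ) (z : ℂ) : ℂ := 2 * cosh ((z - β j) / 2)

section siteFunctions

variable (β : ℤ → ℝ) (j : ℤ) (z : ℂ)

lemma siteSinh_add_pi_mul_I : siteSinh β j (z + Real.pi * I) = I * siteCosh β j z := by
  rw [siteSinh, siteCosh, show (z + Real.pi * I - β j) / 2 = (z - β j) / 2 + (Real.pi / 2 : ℂ) * I
    by ring, sinh_add, cosh_mul_I, sinh_mul_I, cos_pi_div_two, sin_pi_div_two]
  ring

lemma siteCosh_add_pi_mul_I : siteCosh β j (z + Real.pi * I) = I * siteSinh β j z := by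
  rw [siteSinh, siteCosh, show (z + Real.pi * I - β j) / 2 = (z - β j) / 2 + (Real.pi / 2 : ℂ) * I
    by ring, cosh_add, cosh_mul_I, sinh_mul_I, cos_pi_div_two, sin_pi_div_two]
  ring

variable {z}

lemma im_half_sub : ((z - β j) / 2).im = z.im / 2 := by
  rw [show (z - β j) / 2 = ((1 / 2 : ℝ) : ℂ) * (z - β j) by push_cast; ring, im_ofReal_mul]
  simp; ring

lemma re_half_sub : ((z - β j) / 2).re = (z.re - β j) / 2 := by
  rw [show (z - β j) / 2 = ((1 / 2 : ℝ) : ℂ) * (z - β j) by push_cast; ring, re_ofReal_mul]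
  simp; ring

end siteFunctions

section siteFunctions

variable (β : ℤ → ℝ) (j : ℤ) {z : ℂ}

lemma siteSinh_ne_zero (h : Real.sin (z.im / 2) ≠ 0) : siteSinh β j z ≠ 0 :=
  mul_ne_zero two_ne_zero (sinh_ne_zero_of_sin_im_ne_zero (by rwa [im_half_sub]))

lemma siteCosh_ne_zero (h : Real.cos (z.im / 2) ≠ 0) : siteCosh β j z ≠ 0 := by
  have : siteSinh β j (z + Real.pi * I) ≠ 0 := by
    refine siteSinh_ne_zero β j ?_
    simpa [add_div, Real.sin_add_pi_div_two] using h
  rw [siteSinh_add_pi_mul_I] at this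
  exact right_ne_zero_of_mul this

lemma differentiable_siteSinh : Differentiable ℂ (siteSinh β j) := by
  unfold siteSinh; fun_prop

lemma differentiable_siteCosh : Differentiable ℂ (siteCosh β j) := by
  unfold siteCosh; fun_prop

variable {δ : ℝ}

lemma norm_inv_siteSinh_le (hδ : 0 < δ) (h : δ ≤ |Real.sin (z.im / 2)|) :
    ‖(siteSinh β j z)⁻¹‖ ≤ δ⁻¹ * Real.exp (|β j| / 2) * Real.exp (-|z.re| / 2) := by
  have h1 := le_norm_sinh ((z - β j) / 2)
  rw [im_half_sub, re_half_sub] at h1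
  have h2 := inv_cosh_sub_le (z.re / 2) (β j / 2)
  rw [← sub_div, abs_div, abs_div, abs_two] at h2
  have hc := Real.cosh_pos ((z.re - β j) / 2)
  have h3 : 2 * (δ * Real.cosh ((z.re - β j) / 2)) ≤ ‖siteSinh β j z‖ := by
    rw [siteSinh, norm_mul, norm_ofNat]
    gcongr
    exact (mul_le_mul_of_nonneg_right h hc.le).trans h1
  rw [norm_inv]
  calc ‖siteSinh β j z‖⁻¹ ≤ (2 * (δ * Real.cosh ((z.re - β j) / 2)))⁻¹ := by gcongr
    _ = 2⁻¹ * δ⁻¹ * (Real.cosh ((z.re - β j) / 2))⁻¹ := by rw [mul_inv, mul_inv]; ring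
    _ ≤ 2⁻¹ * δ⁻¹ * (2 * Real.exp (|β j| / 2) * Real.exp (-(|z.re| / 2))) := by gcongr
    _ = _ := by rw [neg_div]; ring

lemma norm_siteCosh_div_siteSinh_le (hδ : 0 < δ) (h : δ ≤ |Real.sin (z.im / 2)|) :
    ‖siteCosh β j z / siteSinh β j z‖ ≤ δ⁻¹ := by
  have h1 := le_norm_sinh ((z - β j) / 2)
  have h2 := norm_cosh_le ((z - β j) / 2)
  rw [im_half_sub] at h1
  have hc := Real.cosh_pos ((z - β j) / 2).re
  have h3 : δ * Real.cosh ((z - β j) / 2).re ≤ ‖sinh ((z - β j) / 2)‖ :=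
    (mul_le_mul_of_nonneg_right h hc.le).trans h1
  rw [siteCosh, siteSinh, mul_div_mul_left _ _ two_ne_zero, norm_div]
  rw [div_le_iff₀ ((mul_pos hδ hc).trans_le h3), inv_mul_eq_div, le_div_iff₀ hδ]
  nlinarith

end siteFunctions

/-- The function `1 / (S_m S_l) ∏_{j ∈ J} C_j / S_j` with `S_j = 2 sinh ((z - β_j) / 2)` and
`C_j = 2 cosh ((z - β_j) / 2)`. -/
noncomputable def sinhKernel (β : ℤ → ℝ) (m l : ℤ) (J : Finset ℤ) (z : ℂ) : ℂ :=
  (siteSinh β m z)⁻¹ * (siteSinh β l z)⁻¹ * ∏ j ∈ J, siteCosh β j z / siteSinh β j z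

section sinhKernel

variable (β : ℤ → ℝ) (m l : ℤ) (J : Finset ℤ)

lemma differentiableAt_sinhKernel {z : ℂ} (h : Real.sin (z.im / 2) ≠ 0) :
    DifferentiableAt ℂ (sinhKernel β m l J) z := by
  have h1 := fun j => siteSinh_ne_zero β j h
  have h2 := fun j => (differentiable_siteSinh β j).differentiableAt (x := z)
  have h3 := fun j => (differentiable_siteCosh β j).differentiableAt (x := z)
  unfold sinhKernel
  exact (((h2 m).fun_inv (h1 m)).mul ((h2 l).fun_inv (h1 l))).mul
    (DifferentiableAt.fun_finsetProd fun j _ => (h3 j).fun_div (h2 j) (h1 j))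

/-- Each of the two outer factors decays like exp(-|x|/2), and the ratios C_j / S_j are bounded away
from the lines Im z ∈ 2πℤ that carry the zeros of S_j. -/
lemma exists_norm_sinhKernel_le {δ : ℝ} (hδ : 0 < δ) :
    ∃ M, ∀ z : ℂ, δ ≤ |Real.sin (z.im / 2)| →
      ‖sinhKernel β m l J z‖ ≤ M * Real.exp (-|z.re|) := by
  refine ⟨(δ⁻¹ * Real.exp (|β m| / 2)) * (δ⁻¹ * Real.exp (|β l| / 2)) * δ⁻¹ ^ J.card,
    fun z h => ?_⟩
  rw [sinhKernel, norm_mul, norm_mul, norm_prod]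
  calc _ ≤ (δ⁻¹ * Real.exp (|β m| / 2) * Real.exp (-|z.re| / 2)) *
        (δ⁻¹ * Real.exp (|β l| / 2) * Real.exp (-|z.re| / 2)) * ∏ _j ∈ J, δ⁻¹ := by
        gcongr with j
        · exact norm_inv_siteSinh_le β m hδ h
        · exact norm_inv_siteSinh_le β l hδ h
        · exact norm_siteCosh_div_siteSinh_le β j hδ h
    _ = _ := by
        have : Real.exp (-|z.re|) = Real.exp (-|z.re| / 2) * Real.exp (-|z.re| / 2) := by
          rw [← Real.exp_add]; ring_nf
        rw [this, Finset.prod_const]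
        ring

lemma integrable_sinhKernel {y : ℝ} (h : Real.sin (y / 2) ≠ 0) :
    Integrable fun x : ℝ => sinhKernel β m l J (x + y * I) := by
  obtain ⟨M, hM⟩ := exists_norm_sinhKernel_le β m l J (abs_pos.2 h)
  exact integrable_line_of_norm_le
    (fun z hz => differentiableAt_sinhKernel β m l J (by rwa [hz]))
    fun z hz => hM z (by rw [hz])

lemma integral_sinhKernel_eq {y₁ y₂ : ℝ} (h₁ : 0 < y₁) (h : y₁ ≤ y₂) (h₂ : y₂ < 2 * Real.pi) :
    ∫ x : ℝ, sinhKernel β m l J (x + y₁ * I) = ∫ x : ℝ, sinhKernel β m l J (x + y₂ * I) := by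
  obtain ⟨δ, hδ, hs⟩ := exists_pos_le_sin (y₁ := y₁ / 2) (y₂ := y₂ / 2) (by linarith) (by linarith)
  obtain ⟨M, hM⟩ := exists_norm_sinhKernel_le β m l J hδ
  have hs' : ∀ y ∈ Set.Icc y₁ y₂, δ ≤ |Real.sin (y / 2)| := fun y hy =>
    hs _ ⟨by linarith [hy.1], by linarith [hy.2]⟩
  have hs0 : ∀ y ∈ Set.Icc y₁ y₂, Real.sin (y / 2) ≠ 0 := fun y hy =>
    abs_pos.1 (hδ.trans_le (hs' y hy))
  exact integral_line_eq_of_differentiableOn h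
    (fun z hz => differentiableAt_sinhKernel β m l J (hs0 _ hz)) (fun z hz => hM z (hs' _ hz))
    (integrable_sinhKernel β m l J (hs0 _ (Set.left_mem_Icc.2 h)))
    (integrable_sinhKernel β m l J (hs0 _ (Set.right_mem_Icc.2 h)))

lemma sinhKernel_add_pi_mul_I (z : ℂ) :
    sinhKernel β m l J (z + Real.pi * I) =
      -((siteCosh β m z)⁻¹ * (siteCosh β l z)⁻¹ * ∏ j ∈ J, siteSinh β j z / siteCosh β j z) := by
  simp only [sinhKernel, siteSinh_add_pi_mul_I, siteCosh_add_pi_mul_I, mul_div_mul_left _ _ I_ne_zero,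
    mul_inv, inv_I]
  linear_combination (siteCosh β m z)⁻¹ * (siteCosh β l z)⁻¹ *
    (∏ j ∈ J, siteSinh β j z / siteCosh β j z) * I_sq

lemma sinhKernel_add_two_pi_mul_I (z : ℂ) :
    sinhKernel β m l J (z + 2 * Real.pi * I) = sinhKernel β m l J z := by
  rw [show z + 2 * Real.pi * I = z + Real.pi * I + Real.pi * I by ring, sinhKernel_add_pi_mul_I]
  simp only [sinhKernel, siteSinh_add_pi_mul_I, siteCosh_add_pi_mul_I, mul_div_mul_left _ _ I_ne_zero,
    mul_inv, inv_I]
  linear_combination -(siteSinh β m z)⁻¹ * (siteSinh β l z)⁻¹ *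
    (∏ j ∈ J, siteCosh β j z / siteSinh β j z) * I_sq

end sinhKernel

/-- The one-variable integrand of the two-point function of the sites `m` and `l`. -/
noncomputable def siteKernel (β : ℤ → ℝ) (m l : ℤ) (z : ℂ) : ℂ :=
  if m = l then (siteSinh β m z)⁻¹ * (siteCosh β m z)⁻¹
  else if m < l then sinhKernel β m l (Finset.Ioo m l) z
  else (siteCosh β m z)⁻¹ * (siteCosh β l z)⁻¹ *
    ∏ j ∈ Finset.Ioo l m, siteSinh β j z / siteCosh β j z

section siteKernel

variable (β : ℤ → ℝ) {c : ℝ} {m l : ℤ}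

lemma siteSinh_mul_siteCosh (z : ℂ) :
    siteSinh β m z * siteCosh β m z = 2 * sinh (z - β m) := by
  rw [siteSinh, siteCosh, show z - β m = 2 * ((z - β m) / 2) by ring, sinh_two_mul]
  ring_nf

lemma siteKernel_self (z : ℂ) : siteKernel β m m z = (2 * sinh (z - β m))⁻¹ := by
  rw [siteKernel, if_pos rfl, ← mul_inv, siteSinh_mul_siteCosh]

lemma siteKernel_of_lt (h : m < l) (z : ℂ) :
    siteKernel β m l z = sinhKernel β m l (Finset.Ioo m l) z := by
  rw [siteKernel, if_neg h.ne, if_pos h]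

lemma siteKernel_of_gt (h : l < m) (z : ℂ) :
    siteKernel β m l z = -sinhKernel β m l (Finset.Ioo l m) (z + Real.pi * I) := by
  rw [siteKernel, if_neg h.ne', if_neg h.not_gt, sinhKernel_add_pi_mul_I, neg_neg]

lemma differentiableAt_siteKernel_self {z : ℂ} (h : Real.sin z.im ≠ 0) :
    DifferentiableAt ℂ (siteKernel β m m) z := by
  have : siteKernel β m m = fun z : ℂ => (2 * sinh (z - β m))⁻¹ := funext (siteKernel_self β)
  rw [this]
  refine DifferentiableAt.fun_inv (by fun_prop) (mul_ne_zero two_ne_zero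
    (sinh_ne_zero_of_sin_im_ne_zero (by simpa using h)))

lemma exists_norm_siteKernel_self_le {δ : ℝ} (hδ : 0 < δ) :
    ∃ M, ∀ z : ℂ, δ ≤ |Real.sin z.im| → ‖siteKernel β m m z‖ ≤ M * Real.exp (-|z.re|) := by
  refine ⟨δ⁻¹ * Real.exp |β m|, fun z h => ?_⟩
  have h1 := le_norm_sinh (z - β m)
  simp only [sub_im, sub_re, ofReal_im, ofReal_re, sub_zero] at h1
  have hc := Real.cosh_pos (z.re - β m)
  have h2 := inv_cosh_sub_le z.re (β m)
  rw [siteKernel_self, norm_inv, norm_mul, norm_ofNat]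
  calc (2 * ‖sinh (z - β m)‖)⁻¹ ≤ (2 * (δ * Real.cosh (z.re - β m)))⁻¹ := by
        gcongr
        exact (mul_le_mul_of_nonneg_right h hc.le).trans h1
    _ = 2⁻¹ * δ⁻¹ * (Real.cosh (z.re - β m))⁻¹ := by rw [mul_inv, mul_inv]; ring
    _ ≤ 2⁻¹ * δ⁻¹ * (2 * Real.exp |β m| * Real.exp (-|z.re|)) := by gcongr
    _ = _ := by ring

lemma integrable_siteKernel_self {y : ℝ} (h : Real.sin y ≠ 0) :
    Integrable fun x : ℝ => siteKernel β m m (x + y * I) := by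
  obtain ⟨M, hM⟩ := exists_norm_siteKernel_self_le β (m := m) (abs_pos.2 h)
  exact integrable_line_of_norm_le
    (fun z hz => differentiableAt_siteKernel_self β (by rwa [hz]))
    fun z hz => hM z (by rw [hz])

lemma integrable_siteKernel {y : ℝ} (h : Real.sin y ≠ 0) :
    Integrable fun x : ℝ => siteKernel β m l (x + y * I) := by
  have hy : Real.sin y = 2 * Real.sin (y / 2) * Real.cos (y / 2) := by
    rw [← Real.sin_two_mul]; ring_nf
  rw [hy] at h
  have hc : Real.cos (y / 2) ≠ 0 := right_ne_zero_of_mul h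
  have hs : Real.sin (y / 2) ≠ 0 := right_ne_zero_of_mul (left_ne_zero_of_mul h)
  rcases lt_trichotomy m l with hml | rfl | hml
  · simp only [siteKernel_of_lt β hml]
    exact integrable_sinhKernel β m l _ hs
  · exact integrable_siteKernel_self β (by rwa [hy])
  · simp only [siteKernel_of_gt β hml]
    have := integrable_sinhKernel β m l (Finset.Ioo l m) (y := y + Real.pi)
      (by rwa [add_div, Real.sin_add_pi_div_two])
    refine this.neg.congr (Filter.Eventually.of_forall fun x => ?_)
    simp only [Pi.neg_apply, ofReal_add]
    ring_nf

/-- For m > l the denominators are cosh factors only, with no zero between the two lines. For m < l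
there are poles on the real axis, but the kernel is 2πi-periodic and holomorphic for 0 < Im z < 2π,
so the upper line can be moved up to 2π - c, a translate of the lower one. -/
lemma integral_siteKernel_neg_of_ne (hc : 0 < c) (hc' : c < Real.pi / 2) (h : m ≠ l) :
    ∫ x : ℝ, siteKernel β m l (x + (-c : ℝ) * I) = ∫ x : ℝ, siteKernel β m l (x + c * I) := by
  rcases lt_or_gt_of_ne h with hml | hml
  · simp only [siteKernel_of_lt β hml]
    rw [integral_sinhKernel_eq β m l _ hc (y₂ := 2 * Real.pi - c) (by linarith) (by linarith)]
    refine integral_congr_ae (Filter.Eventually.of_forall fun x => ?_)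
    simp only []
    rw [← sinhKernel_add_two_pi_mul_I]
    congr 1
    push_cast
    ring
  · simp only [siteKernel_of_gt β hml, integral_neg]
    have := integral_sinhKernel_eq β m l (Finset.Ioo l m) (y₁ := Real.pi - c) (y₂ := Real.pi + c)
      (by linarith) (by linarith) (by linarith)
    have h1 : ∀ x : ℝ, (x + (-c : ℝ) * I + Real.pi * I : ℂ) = x + (Real.pi - c : ℝ) * I := by
      intro x; push_cast; ring
    have h2 : ∀ x : ℝ, (x + c * I + Real.pi * I : ℂ) = x + (Real.pi + c : ℝ) * I := by
      intro x; push_cast; ring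
    simp only [h1, h2, this]

/-- The line is moved up to Im z = π/2, where sinh becomes i cosh and the integral is elementary.
For m = l the kernel is only antiperiodic under 2πi/2, so the argument for m ≠ l gives no equality
of the two lines. -/
lemma integral_siteKernel_self (hc : 0 < c) (hc' : c < Real.pi / 2) :
    ∫ x : ℝ, siteKernel β m m (x + c * I) = -(Real.pi * I / 2) := by
  obtain ⟨δ, hδ, hs⟩ := exists_pos_le_sin (y₁ := c) (y₂ := Real.pi / 2) hc
    (by linarith [Real.pi_pos])
  obtain ⟨M, hM⟩ := exists_norm_siteKernel_self_le β (m := m) hδ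
  have hs0 : ∀ y ∈ Set.Icc c (Real.pi / 2), Real.sin y ≠ 0 := fun y hy =>
    abs_pos.1 (hδ.trans_le (hs y hy))
  rw [integral_line_eq_of_differentiableOn hc'.le
    (fun z hz => differentiableAt_siteKernel_self β (hs0 _ hz)) (fun z hz => hM z (hs _ hz))
    (integrable_siteKernel_self β (hs0 _ (Set.left_mem_Icc.2 hc'.le)))
    (integrable_siteKernel_self β (hs0 _ (Set.right_mem_Icc.2 hc'.le)))]
  have : ∀ x : ℝ, siteKernel β m m (x + (Real.pi / 2 : ℝ) * I) =
      -(I / 2) * (((Real.cosh (x - β m))⁻¹ : ℝ) : ℂ) := by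
    intro x
    rw [siteKernel_self, show (x + (Real.pi / 2 : ℝ) * I - β m : ℂ) =
      ((x - β m : ℝ) : ℂ) + (Real.pi / 2 : ℂ) * I by push_cast; ring, sinh_add, cosh_mul_I,
      sinh_mul_I, cos_pi_div_two, sin_pi_div_two, ← ofReal_cosh]
    simp only [mul_zero, one_mul, zero_add, mul_inv, inv_I, ofReal_inv]
    ring
  simp only [this]
  rw [integral_const_mul, integral_complex_ofReal, integral_sub_right_eq_self fun x => (Real.cosh x)⁻¹,
    integral_inv_cosh]
  ring

lemma integral_siteKernel_self_neg (hc : 0 < c) (hc' : c < Real.pi / 2) :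
    ∫ x : ℝ, siteKernel β m m (x + (-c : ℝ) * I) = Real.pi * I / 2 := by
  rw [← neg_neg (Real.pi * I / 2 : ℂ), ← integral_siteKernel_self β (m := m) hc hc',
    -- Reflection in the pole β_m maps the upper line to the lower one, and the kernel is odd about
    -- that point.
    ← integral_sub_left_eq_self (fun x : ℝ => siteKernel β m m (x + c * I)) volume (2 * β m),
    ← integral_neg]
  refine integral_congr_ae (Filter.Eventually.of_forall fun x => ?_)
  simp only [siteKernel_self]
  rw [show (((2 * β m - x : ℝ) : ℂ) + c * I - β m) = -(x + (-c : ℝ) * I - β m) by push_cast; ring,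
    sinh_neg, mul_neg, inv_neg, neg_neg]

/-- The difference of the integrals over the lower and the upper line. -/
lemma integral_siteKernel_neg (hc : 0 < c) (hc' : c < Real.pi / 2) :
    ∫ x : ℝ, siteKernel β m l (x + (-c : ℝ) * I) =
      (∫ x : ℝ, siteKernel β m l (x + c * I)) + if m = l then Real.pi * I else 0 := by
  split_ifs with h
  · subst h
    rw [integral_siteKernel_self β hc hc', integral_siteKernel_self_neg β hc hc']
    ring
  · rw [integral_siteKernel_neg_of_ne β hc hc' h, add_zero]

end siteKernel

/-! ### Factorization of the one-variable factors -/

section products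

variable {A : Type*} [CommMonoid A] {n : ℕ} (f : Fin n → A)

lemma prod_univ_eq_prod_Iio_mul_prod_Ioi (a : Fin n) :
    ∏ j, f j = (∏ j ∈ Finset.Iio a, f j) * f a * ∏ j ∈ Finset.Ioi a, f j := by
  have : (Finset.univ : Finset (Fin n)) = Finset.Iio a ∪ insert a (Finset.Ioi a) := by
    ext j
    simp only [Finset.mem_univ, Finset.mem_union, Finset.mem_Iio, Finset.mem_insert,
      Finset.mem_Ioi, true_iff]
    omega
  rw [this, Finset.prod_union, Finset.prod_insert, mul_assoc]
  · simp
  · rw [Finset.disjoint_left]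
    intro j hj hj'
    simp only [Finset.mem_Iio, Finset.mem_insert, Finset.mem_Ioi] at hj hj'
    omega

lemma prod_Iio_of_lt {a b : Fin n} (h : a < b) :
    ∏ j ∈ Finset.Iio b, f j = (∏ j ∈ Finset.Iio a, f j) * f a * ∏ j ∈ Finset.Ioo a b, f j := by
  have : Finset.Iio b = Finset.Iio a ∪ insert a (Finset.Ioo a b) := by
    ext j
    simp only [Finset.mem_Iio, Finset.mem_union, Finset.mem_insert, Finset.mem_Ioo]
    omega
  rw [this, Finset.prod_union, Finset.prod_insert, mul_assoc]
  · simp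
  · rw [Finset.disjoint_left]
    intro j hj hj'
    simp only [Finset.mem_Iio, Finset.mem_insert, Finset.mem_Ioo] at hj hj'
    omega

lemma prod_Ioi_of_lt {a b : Fin n} (h : a < b) :
    ∏ j ∈ Finset.Ioi a, f j = (∏ j ∈ Finset.Ioo a b, f j) * f b * ∏ j ∈ Finset.Ioi b, f j := by
  have : Finset.Ioi a = Finset.Ioo a b ∪ insert b (Finset.Ioi b) := by
    ext j
    simp only [Finset.mem_Ioi, Finset.mem_union, Finset.mem_insert, Finset.mem_Ioo]
    omega
  rw [this, Finset.prod_union, Finset.prod_insert, mul_assoc]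
  · simp
  · rw [Finset.disjoint_left]
    intro j hj hj'
    simp only [Finset.mem_Ioi, Finset.mem_insert, Finset.mem_Ioo] at hj hj'
    omega

lemma prod_Ioo_window (r : ℤ) (F : ℤ → A) (a b : Fin n) :
    ∏ j ∈ Finset.Ioo a b, F (r + (j : ℕ)) =
      ∏ j ∈ Finset.Ioo (r + ((a : ℕ) : ℤ)) (r + ((b : ℕ) : ℤ)), F j := by
  refine Finset.prod_nbij (fun j => r + ((j : ℕ) : ℤ)) ?_ ?_ ?_ fun _ _ => rfl
  · intro j hj
    simp only [Finset.mem_Ioo, Fin.lt_def] at hj ⊢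
    omega
  · intro i _ j _ h
    simp only at h
    exact Fin.ext (by omega)
  · intro j hj
    simp only [Finset.coe_Ioo, Set.mem_Ioo] at hj
    have := b.2
    exact ⟨⟨(j - r).toNat, by omega⟩, by
      simp only [Finset.coe_Ioo, Set.mem_Ioo, Fin.lt_def]; omega, by simp only []; omega⟩

end products

section oneBody

variable (β : ℤ → ℝ) (r : ℤ) {n : ℕ}

/-- The function `1 / (S_a C_a) ∏_{j < a} 1 / C_j ∏_{j > a} 1 / S_j` on a window of sites. -/
noncomputable def rowFun (a : Fin n) (z : ℂ) : ℂ :=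
  (siteSinh β (r + (a : ℕ)) z)⁻¹ * (siteCosh β (r + (a : ℕ)) z)⁻¹ *
    ((∏ j ∈ Finset.Iio a, (siteCosh β (r + (j : ℕ)) z)⁻¹) *
      ∏ j ∈ Finset.Ioi a, (siteSinh β (r + (j : ℕ)) z)⁻¹)

lemma columnFun_windowParams (b : Fin n) (z : ℂ) :
    columnFun (fun j => (windowParams β r n j : ℂ)) b z =
      (∏ j ∈ Finset.Iio b, siteCosh β (r + (j : ℕ)) z) *
        ∏ j ∈ Finset.Ioi b, siteSinh β (r + (j : ℕ)) z := rfl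

variable {β r} {z : ℂ}

/-- All factors at sites outside the interval between `a` and `b` cancel, which is why the entries
do not see the window. -/
lemma rowFun_mul_columnFun (hs : ∀ j, siteSinh β j z ≠ 0) (hc : ∀ j, siteCosh β j z ≠ 0)
    (a b : Fin n) :
    rowFun β r a z * columnFun (fun j => (windowParams β r n j : ℂ)) b z =
      siteKernel β (r + (a : ℕ)) (r + (b : ℕ)) z := by
  have hsp : ∀ J : Finset (Fin n), ∏ j ∈ J, siteSinh β (r + (j : ℕ)) z ≠ 0 := fun J =>
    Finset.prod_ne_zero_iff.2 fun j _ => hs _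
  have hcp : ∀ J : Finset (Fin n), ∏ j ∈ J, siteCosh β (r + (j : ℕ)) z ≠ 0 := fun J =>
    Finset.prod_ne_zero_iff.2 fun j _ => hc _
  have hsa := hs (r + (a : ℕ))
  have hsb := hs (r + (b : ℕ))
  have hca := hc (r + (a : ℕ))
  have hcb := hc (r + (b : ℕ))
  rw [columnFun_windowParams, rowFun]
  simp only [Finset.prod_inv_distrib]
  rcases lt_trichotomy a b with h | rfl | h
  · have h' : r + ((a : ℕ) : ℤ) < r + ((b : ℕ) : ℤ) := by
      simp only [Fin.lt_def] at h; omega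
    rw [siteKernel_of_lt β h', sinhKernel,
      ← prod_Ioo_window r (fun j => siteCosh β j z / siteSinh β j z), Finset.prod_div_distrib,
      prod_Iio_of_lt (fun j => siteCosh β (r + (j : ℕ)) z) h,
      prod_Ioi_of_lt (fun j => siteSinh β (r + (j : ℕ)) z) h]
    have h1 := hsp (Finset.Ioo a b)
    have h2 := hsp (Finset.Ioi b)
    have h3 := hcp (Finset.Iio a)
    field_simp
  · rw [siteKernel, if_pos rfl]
    have h2 := hsp (Finset.Ioi a)
    have h3 := hcp (Finset.Iio a)
    field_simp
  · have h' : r + ((b : ℕ) : ℤ) < r + ((a : ℕ) : ℤ) := by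
      simp only [Fin.lt_def] at h; omega
    rw [siteKernel, if_neg h'.ne', if_neg h'.not_gt,
      ← prod_Ioo_window r (fun j => siteSinh β j z / siteCosh β j z), Finset.prod_div_distrib,
      prod_Iio_of_lt (fun j => siteCosh β (r + (j : ℕ)) z) h,
      prod_Ioi_of_lt (fun j => siteSinh β (r + (j : ℕ)) z) h]
    have h1 := hcp (Finset.Ioo b a)
    have h2 := hsp (Finset.Ioi a)
    have h3 := hcp (Finset.Iio b)
    field_simp

lemma sinh_half_mul_sub (j : ℤ) : sinh (((1 / 2 : ℝ) : ℂ) * (z - β j)) = siteSinh β j z / 2 := by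
  rw [siteSinh, mul_div_cancel_left₀ _ two_ne_zero]
  congr 1
  push_cast
  ring

lemma sinh_half_mul_neg_add (j : ℤ) :
    sinh (((1 / 2 : ℝ) : ℂ) * (-z + β j)) = -(siteSinh β j z / 2) := by
  rw [← sinh_half_mul_sub, ← sinh_neg]
  congr 1
  ring

lemma sinh_half_mul_sub_add_pi (j : ℤ) :
    sinh (((1 / 2 : ℝ) : ℂ) * (z - β j + Real.pi * I)) = I * siteCosh β j z / 2 := by
  rw [← siteSinh_add_pi_mul_I, ← sinh_half_mul_sub]
  congr 1
  ring

lemma sinh_half_mul_neg_add_add_pi (j : ℤ) :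
    sinh (((1 / 2 : ℝ) : ℂ) * (-z + β j + Real.pi * I)) = I * siteCosh β j z / 2 := by
  rw [show (((1 / 2 : ℝ) : ℂ) * (-z + β j + Real.pi * I)) =
    -(((1 / 2 : ℝ) : ℂ) * (z - β j + Real.pi * I)) + Real.pi * I by push_cast; ring,
    sinh_add_pi_mul_I, sinh_neg, neg_neg, sinh_half_mul_sub_add_pi]

lemma sinh_sub_eq (j : ℤ) : sinh (z - β j) = siteSinh β j z * siteCosh β j z / 2 := by
  rw [siteSinh_mul_siteCosh, mul_div_cancel_left₀ _ two_ne_zero]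

/-- The site of a position. -/
def positionSite (p : Fin (n + n)) : Fin n :=
  Fin.addCases (fun a => a) (fun q => q.rev) p

/-- The constant relating the one-variable factor of a position to `rowFun`. -/
noncomputable def positionCoeff (p : Fin (n + n)) : ℂ :=
  Fin.addCases (fun a : Fin n => I ^ n * I ^ (n - 1 - (a : ℕ)))
    (fun q : Fin n => (-I) ^ n * (-1) ^ (q.rev : ℕ) * I ^ (n - 1 - (q.rev : ℕ))) p

/-- At ν = 1/2 the shift by πi turns S_j into C_j, and sinh(z - β_j) = S_j C_j / 2. Both kinds of
position therefore give the same function of z at a given site, up to a constant. -/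
lemma oneBodyFactor_eq (hs : ∀ j, siteSinh β j z ≠ 0) (hc : ∀ j, siteCosh β j z ≠ 0)
    (p : Fin (n + n)) :
    oneBodyFactor (1 / 2 : ℝ) (windowParams β r n) p z =
      2 * positionCoeff p * rowFun β r (positionSite p) z := by
  have key : ∀ (e s : ℂ) (a : Fin n), (∏ j : Fin n, e / sinh (z - β (r + (j : ℕ)))) *
      (∏ j ∈ Finset.Iio a, s * (siteSinh β (r + (j : ℕ)) z / 2)) *
      (∏ j ∈ Finset.Ioi a, I * siteCosh β (r + (j : ℕ)) z / 2) =
      2 * (e ^ n * s ^ (a : ℕ) * I ^ (n - 1 - (a : ℕ))) * rowFun β r a z := by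
    intro e s a
    have h1 : ∏ j : Fin n, e / sinh (z - β (r + (j : ℕ))) =
        e ^ n * ∏ j : Fin n, (2 * (siteSinh β (r + (j : ℕ)) z)⁻¹ *
          (siteCosh β (r + (j : ℕ)) z)⁻¹) := by
      rw [← Fin.prod_const, ← Finset.prod_mul_distrib]
      refine Finset.prod_congr rfl fun j _ => ?_
      rw [sinh_sub_eq]
      have := hs (r + (j : ℕ))
      have := hc (r + (j : ℕ))
      field_simp
    have h2 : (∏ j ∈ Finset.Iio a, (2 * (siteSinh β (r + (j : ℕ)) z)⁻¹ *
          (siteCosh β (r + (j : ℕ)) z)⁻¹)) *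
        (∏ j ∈ Finset.Iio a, s * (siteSinh β (r + (j : ℕ)) z / 2)) =
        s ^ (a : ℕ) * ∏ j ∈ Finset.Iio a, (siteCosh β (r + (j : ℕ)) z)⁻¹ := by
      have : s ^ (a : ℕ) = ∏ _j ∈ Finset.Iio a, s := by simp
      rw [this, ← Finset.prod_mul_distrib, ← Finset.prod_mul_distrib]
      refine Finset.prod_congr rfl fun j _ => ?_
      have := hs (r + (j : ℕ))
      field_simp
    have h3 : (∏ j ∈ Finset.Ioi a, (2 * (siteSinh β (r + (j : ℕ)) z)⁻¹ *
          (siteCosh β (r + (j : ℕ)) z)⁻¹)) *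
        (∏ j ∈ Finset.Ioi a, I * siteCosh β (r + (j : ℕ)) z / 2) =
        I ^ (n - 1 - (a : ℕ)) * ∏ j ∈ Finset.Ioi a, (siteSinh β (r + (j : ℕ)) z)⁻¹ := by
      have : I ^ (n - 1 - (a : ℕ)) = ∏ _j ∈ Finset.Ioi a, I := by simp
      rw [this, ← Finset.prod_mul_distrib, ← Finset.prod_mul_distrib]
      refine Finset.prod_congr rfl fun j _ => ?_
      have := hc (r + (j : ℕ))
      field_simp
    rw [h1, prod_univ_eq_prod_Iio_mul_prod_Ioi _ a, rowFun]
    linear_combination (e ^ n * (2 * (siteSinh β (r + (a : ℕ)) z)⁻¹ *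
      (siteCosh β (r + (a : ℕ)) z)⁻¹)) *
      ((∏ j ∈ Finset.Ioi a, (2 * (siteSinh β (r + (j : ℕ)) z)⁻¹ *
          (siteCosh β (r + (j : ℕ)) z)⁻¹)) *
        (∏ j ∈ Finset.Ioi a, I * siteCosh β (r + (j : ℕ)) z / 2) * h2 +
        (s ^ (a : ℕ) * ∏ j ∈ Finset.Iio a, (siteCosh β (r + (j : ℕ)) z)⁻¹) * h3)
  refine Fin.addCases (fun a => ?_) (fun q => ?_) p
  · have h := key I 1 a
    simp only [one_mul, one_pow, mul_one] at h
    simp only [oneBodyFactor, positionCoeff, positionSite, Fin.addCases_left, windowParams,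
      sinh_half_mul_sub, sinh_half_mul_neg_add_add_pi, h]
  · have h := key (-I) (-1) q.rev
    simp only [neg_one_mul] at h
    simp only [oneBodyFactor, positionCoeff, positionSite, Fin.addCases_right, windowParams,
      sinh_half_mul_neg_add, sinh_half_mul_sub_add_pi, h]

end oneBody

lemma sinhRatio_half (t : ℝ) : (sinhRatio (1 / 2) t : ℂ) = 2 * cosh ((t : ℂ) / 2) := by
  rw [sinhRatio]
  split_ifs with h
  · simp [h]
  · have hs : Real.sinh (1 / 2 * t) ≠ 0 := by
      rw [Ne, Real.sinh_eq_zero]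
      simpa using h
    have : Real.sinh t / Real.sinh (1 / 2 * t) = 2 * Real.cosh (t / 2) := by
      rw [div_eq_iff hs]
      conv_lhs => rw [show t = 2 * (t / 2) by ring, Real.sinh_two_mul]
      rw [show 1 / 2 * t = t / 2 by ring]
      ring
    rw [this]
    push_cast
    rfl

lemma sinh_div_sinh_half_sub {w : ℂ} (h : Real.cos (w.im / 2) ≠ 0) :
    sinh w / sinh (((1 / 2 : ℝ) : ℂ) * (w - Real.pi * I)) = I * (2 * sinh (w / 2)) := by
  have h1 := siteCosh_ne_zero (fun _ => 0) 0 h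
  simp only [siteCosh, ofReal_zero, sub_zero] at h1
  have h2 : cosh (w / 2) ≠ 0 := right_ne_zero_of_mul h1
  have h3 : sinh (((1 / 2 : ℝ) : ℂ) * (w - Real.pi * I)) = -I * cosh (w / 2) := by
    rw [show ((1 / 2 : ℝ) : ℂ) * (w - Real.pi * I) = w / 2 - (Real.pi / 2 : ℂ) * I by
      push_cast; ring, sinh_sub, cosh_mul_I, sinh_mul_I, cos_pi_div_two, sin_pi_div_two]
    ring
  rw [h3, div_eq_iff (mul_ne_zero (neg_ne_zero.2 I_ne_zero) h2)]
  conv_lhs => rw [show w = 2 * (w / 2) by ring, sinh_two_mul]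
  linear_combination 2 * sinh (w / 2) * cosh (w / 2) * I_sq

/-! ### The integrand as a determinant, and its integral -/

section contour

variable {c : ℝ} {n : ℕ}

lemma contourPoint_im (p : Fin (n + n)) (x : ℝ) :
    (contourPoint c p x).im = c ∨ (contourPoint c p x).im = -c := by
  refine Fin.addCases (fun a => ?_) (fun q => ?_) p
  · simp [contourPoint]
  · right; simp only [contourPoint, Fin.addCases_right]; simp

lemma sin_ne_zero_of_contour (hc : 0 < c) (hc' : c < Real.pi / 2) (p : Fin (n + n)) (x : ℝ) :
    Real.sin ((contourPoint c p x).im / 2) ≠ 0 := by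
  have : 0 < Real.sin (c / 2) := Real.sin_pos_of_pos_of_lt_pi (by linarith)
    (by linarith [Real.pi_pos])
  rcases contourPoint_im (c := c) p x with h | h <;> rw [h]
  · exact this.ne'
  · rw [neg_div, Real.sin_neg]
    exact neg_ne_zero.2 this.ne'

lemma cos_ne_zero_of_contour (hc : 0 < c) (hc' : c < Real.pi / 2) (p : Fin (n + n)) (x : ℝ) :
    Real.cos ((contourPoint c p x).im / 2) ≠ 0 := by
  have : 0 < Real.cos (c / 2) := Real.cos_pos_of_mem_Ioo ⟨by linarith, by linarith⟩
  rcases contourPoint_im (c := c) p x with h | h <;> rw [h]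
  · exact this.ne'
  · rw [neg_div, Real.cos_neg]
    exact this.ne'

lemma cos_sub_ne_zero_of_contour (hc : 0 < c) (hc' : c < Real.pi / 2) (p q : Fin (n + n))
    (x y : ℝ) : Real.cos ((contourPoint c p x - contourPoint c q y).im / 2) ≠ 0 := by
  have h0 : 0 < Real.cos c := Real.cos_pos_of_mem_Ioo ⟨by linarith, by linarith⟩
  rw [sub_im]
  rcases contourPoint_im (c := c) p x with h | h <;>
    rcases contourPoint_im (c := c) q y with h' | h' <;> rw [h, h']
  · simp
  · rw [show (c - -c) / 2 = c by ring]; exact h0.ne'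
  · rw [show (-c - c) / 2 = -c by ring, Real.cos_neg]; exact h0.ne'
  · simp

/-- The entries of the determinant whose integral is the correlator. -/
noncomputable def contourEntry (β : ℤ → ℝ) (r : ℤ) (c : ℝ) (p : Fin (n + n)) (b : Fin n) (x : ℝ) :
    ℂ :=
  positionCoeff p / Real.pi *
    siteKernel β (r + (positionSite p : ℕ)) (r + (b : ℕ)) (contourPoint c p x)

/-- The product of the factors of the integrand that do not depend on the contours. -/
noncomputable def phaseFactor (n : ℕ) : ℂ := ∏ j : Fin n, ∏ _k ∈ Finset.Ioi j, I

lemma prefactor_mul_corrIntegrand (β : ℤ → ℝ) (r : ℤ) (hc : 0 < c) (hc' : c < Real.pi / 2)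
    (p : Fin n → Fin (n + n)) (x : Fin n → ℝ) :
    (∏ j, ∏ k ∈ Finset.Ioi j, (sinhRatio (1 / 2)
      (windowParams β r n j - windowParams β r n k) : ℂ)) *
        corrIntegrand (1 / 2) c (windowParams β r n) p x =
      phaseFactor n * Matrix.det (Matrix.of fun l b => contourEntry β r c (p l) b (x l)) := by
  have hs := fun l j => siteSinh_ne_zero β j (sin_ne_zero_of_contour hc hc' (p l) (x l))
  have hco := fun l j => siteCosh_ne_zero β j (cos_ne_zero_of_contour hc hc' (p l) (x l))
  set α : Fin n → ℂ := fun l => contourPoint c (p l) (x l) with hα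
  have hmat : (Matrix.of fun l b => contourEntry β r c (p l) b (x l)) = Matrix.of fun l b =>
      (1 / (2 * Real.pi) * oneBodyFactor (1 / 2 : ℝ) (windowParams β r n) (p l) (α l)) *
        (Matrix.of fun l b => columnFun (fun j => (windowParams β r n j : ℂ)) b (α l)) l b := by
    ext l b
    simp only [hα, Matrix.of_apply, contourEntry, oneBodyFactor_eq (hs l) (hco l),
      ← rowFun_mul_columnFun (hs l) (hco l)]
    have : (Real.pi : ℂ) ≠ 0 := ofReal_ne_zero.2 Real.pi_ne_zero
    field_simp
  rw [hmat, Matrix.det_mul_column, det_columnFun, corrIntegrand, phaseFactor]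
  simp only [sinhRatio_half, sinh_div_sinh_half_sub
    (cos_sub_ne_zero_of_contour hc hc' _ _ _ _), Finset.prod_mul_distrib, ofReal_sub, hα]
  ring

end contour

lemma integrable_det {n : ℕ} {g : Fin n → Fin n → ℝ → ℂ} (hg : ∀ l b, Integrable (g l b)) :
    Integrable fun x : Fin n → ℝ => Matrix.det (Matrix.of fun l b => g l b (x l)) := by
  simp only [← Matrix.det_transpose (Matrix.of _), Matrix.det_apply', Matrix.transpose_apply,
    Matrix.of_apply]
  exact integrable_finsetSum _ fun σ _ =>
    (Integrable.fintype_prod fun l => hg l (σ l)).const_mul _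

/-- Row l depends on x_l alone, so each term of the Leibniz expansion is a product of one-variable
functions and integrates by Fubini. -/
lemma integral_det {n : ℕ} {g : Fin n → Fin n → ℝ → ℂ} (hg : ∀ l b, Integrable (g l b)) :
    ∫ x : Fin n → ℝ, Matrix.det (Matrix.of fun l b => g l b (x l)) =
      Matrix.det (Matrix.of fun l b => ∫ t, g l b t) := by
  simp only [← Matrix.det_transpose (Matrix.of _), Matrix.det_apply', Matrix.transpose_apply,
    Matrix.of_apply]
  rw [integral_finsetSum _ fun σ _ => (Integrable.fintype_prod fun l => hg l (σ l)).const_mul _]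
  refine Finset.sum_congr rfl fun σ _ => ?_
  rw [integral_const_mul, integral_fintype_prod_volume_eq_prod fun l => g l (σ l)]

/-! ### The correlators as a minor functional; conclusion -/

section correlators

variable (β : ℤ → ℝ) (r : ℤ) {c : ℝ} {n : ℕ}

lemma contourPoint_castAdd (a : Fin n) (x : ℝ) :
    contourPoint c (Fin.castAdd n a) x = x + c * I := by
  simp only [contourPoint, Fin.addCases_left]

lemma contourPoint_natAdd (a : Fin n) (x : ℝ) :
    contourPoint c (Fin.natAdd n a) x = x + (-c : ℝ) * I := by
  simp only [contourPoint, Fin.addCases_right]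
  push_cast
  ring

lemma integrable_contourEntry (hc : 0 < c) (hc' : c < Real.pi / 2) (p : Fin (n + n)) (b : Fin n) :
    Integrable (contourEntry β r c p b) := by
  have hs : Real.sin c ≠ 0 :=
    (Real.sin_pos_of_pos_of_lt_pi hc (by linarith [Real.pi_pos])).ne'
  refine Integrable.const_mul ?_ _
  refine Fin.addCases (fun a => ?_) (fun q => ?_) p
  · simp only [contourPoint_castAdd]
    exact integrable_siteKernel β hs
  · simp only [contourPoint_natAdd]
    exact integrable_siteKernel β (by rwa [Real.sin_neg, neg_ne_zero])

lemma prefactor_ne_zero (b : Fin n → ℝ) :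
    (∏ j, ∏ k ∈ Finset.Ioi j, (sinhRatio (1 / 2) (b j - b k) : ℂ)) ≠ 0 := by
  refine Finset.prod_ne_zero_iff.2 fun j _ => Finset.prod_ne_zero_iff.2 fun k _ => ?_
  rw [sinhRatio_half, show ((b j - b k : ℝ) : ℂ) / 2 = ((b j - b k) / 2 : ℝ) by push_cast; ring,
    ← ofReal_cosh]
  exact mul_ne_zero two_ne_zero (ofReal_ne_zero.2 (Real.cosh_pos _).ne')

/-- The integral defining the correlators converges absolutely. -/
lemma integrable_corrIntegrand (hc : 0 < c) (hc' : c < Real.pi / 2) (p : Fin n → Fin (n + n)) :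
    Integrable (corrIntegrand (1 / 2) c (windowParams β r n) p) := by
  have h := (integrable_det (g := fun l => contourEntry β r c (p l))
    fun l b => integrable_contourEntry β r hc hc' (p l) b).const_mul (phaseFactor n)
  simp only [← prefactor_mul_corrIntegrand β r hc hc' p] at h
  exact (integrable_const_mul_iff (IsUnit.mk0 _ (prefactor_ne_zero _)) _).1 h

lemma elementaryCorrelator_eq (hc : 0 < c) (hc' : c < Real.pi / 2) (ε' ε : Fin n → Spin) :
    elementaryCorrelator (1 / 2) c (windowParams β r n) ε' ε =
      minorAmplitude (phaseFactor n) (fun p b => ∫ x, contourEntry β r c p b x)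
        (plusPositions ε' ε) := by
  rw [elementaryCorrelator, minorAmplitude]
  split_ifs with h
  · rw [← integral_const_mul]
    simp only [prefactor_mul_corrIntegrand β r hc hc']
    rw [integral_const_mul, integral_det (g := fun l => contourEntry β r c _)
      fun l b => integrable_contourEntry β r hc hc' _ b]
  · rfl

lemma correlator_eq_minorFunctional (hc : 0 < c) (hc' : c < Real.pi / 2) (O : Op n) :
    correlator (1 / 2) c β r n O =
      minorFunctional (phaseFactor n) (fun p b => ∫ x, contourEntry β r c p b x) O := by
  simp only [correlator, minorFunctional, elementaryCorrelator_eq β r hc hc']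

/-- The integral of `siteKernel` over the upper line. -/
noncomputable def lineIntegral (c : ℝ) (m l : ℤ) : ℂ := ∫ x : ℝ, siteKernel β m l (x + c * I)

lemma integral_contourEntry_castAdd (a b : Fin n) :
    ∫ x, contourEntry β r c (Fin.castAdd n a) b x =
      I ^ n * I ^ (n - 1 - (a : ℕ)) / Real.pi *
        lineIntegral β c (r + (a : ℕ)) (r + (b : ℕ)) := by
  simp only [contourEntry, contourPoint_castAdd, positionCoeff, positionSite, Fin.addCases_left]
  rw [integral_const_mul, lineIntegral]

lemma integral_contourEntry_natAdd (hc : 0 < c) (hc' : c < Real.pi / 2) (a b : Fin n) :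
    (-1) ^ (n + (a : ℕ)) * ∫ x, contourEntry β r c (Fin.natAdd n a.rev) b x =
      I ^ n * I ^ (n - 1 - (a : ℕ)) / Real.pi *
        (lineIntegral β c (r + (a : ℕ)) (r + (b : ℕ)) + if a = b then Real.pi * I else 0) := by
  simp only [contourEntry, contourPoint_natAdd, positionCoeff, positionSite, Fin.addCases_right,
    Fin.rev_rev]
  rw [integral_const_mul, integral_siteKernel_neg β hc hc', lineIntegral]
  have h1 : (r + ((a : ℕ) : ℤ) = r + ((b : ℕ) : ℤ)) ↔ a = b := by
    rw [Fin.ext_iff]; omega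
  have h2 : (-1 : ℂ) ^ (n + (a : ℕ)) * ((-I) ^ n * (-1) ^ (a : ℕ)) = I ^ n := by
    rw [neg_pow I n, pow_add]
    have e1 : ((-1 : ℂ) ^ n) * (-1) ^ n = 1 := by rw [← mul_pow]; simp
    have e2 : ((-1 : ℂ) ^ (a : ℕ)) * (-1) ^ (a : ℕ) = 1 := by rw [← mul_pow]; simp
    linear_combination (I ^ n * ((-1 : ℂ) ^ (a : ℕ)) * (-1) ^ (a : ℕ)) * e1 + I ^ n * e2
  simp only [h1]
  rw [← h2]
  ring

/-- By `minorFunctional_one` only the difference of the two rows over each site matters, and this is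
the diagonal residue. -/
lemma minorFunctional_contourEntry_one (hc : 0 < c) (hc' : c < Real.pi / 2) :
    minorFunctional (phaseFactor n) (fun p b => ∫ x, contourEntry β r c p b x) (1 : Op n) = 1 := by
  have hpi : (Real.pi : ℂ) ≠ 0 := ofReal_ne_zero.2 Real.pi_ne_zero
  have hmat : (Matrix.of fun a b : Fin n => (∫ x, contourEntry β r c (Fin.castAdd n a) b x) -
      (-1) ^ (n + (a : ℕ)) * ∫ x, contourEntry β r c (Fin.natAdd n a.rev) b x) =
      Matrix.diagonal fun a : Fin n => -(I ^ n * I ^ (n - 1 - (a : ℕ)) * I) := by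
    ext a b
    rw [Matrix.of_apply, integral_contourEntry_castAdd, integral_contourEntry_natAdd β r hc hc',
      Matrix.diagonal_apply]
    split_ifs
    · field_simp
      ring
    · ring
  rw [minorFunctional_one, hmat, Matrix.det_diagonal, phaseFactor,
    prod_prod_Ioi_comm fun _ _ => I, ← Finset.prod_mul_distrib]
  -- The share of row a is -I^(a + n + (n-1-a) + 1) = -(-1)^n, independent of a; its n-th power is 1
  -- for n of either parity.
  have h : ∀ a : Fin n, (∏ _j ∈ Finset.Iio a, I) * -(I ^ n * I ^ (n - 1 - (a : ℕ)) * I) =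
      -(-1) ^ n := by
    intro a
    have := a.2
    rw [Finset.prod_const, Fin.card_Iio, ← I_sq, ← pow_mul]
    have : 2 * n = a + n + (n - 1 - a) + 1 := by omega
    rw [this]
    ring
  rw [Finset.prod_congr rfl fun a _ => h a, Finset.prod_const, Finset.card_univ, Fintype.card_fin]
  rcases Nat.even_or_odd n with hn | hn
  · rw [hn.neg_one_pow, hn.neg_one_pow]
  · rw [hn.neg_one_pow, neg_neg, one_pow]

/-- The two-point function `⟨ψ_m ψ*_l⟩`. -/
noncomputable def twoPoint (c : ℝ) (m l : ℤ) : ℂ :=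
  -(I ^ (l - m) * lineIntegral β c m l) / (Real.pi * I)

lemma correlator_fermionMonomial (hc : 0 < c) (hc' : c < Real.pi / 2) {k : ℕ} {m l : Fin k → ℤ}
    (hm : ∀ j, m j ∈ Set.Ico r (r + n)) (hl : ∀ j, l j ∈ Set.Ico r (r + n)) :
    correlator (1 / 2) c β r n (fermionMonomial r n m l) =
      Matrix.det (Matrix.of fun j i => twoPoint β c (m j) (l i)) := by
  have hpi : (Real.pi : ℂ) ≠ 0 := ofReal_ne_zero.2 Real.pi_ne_zero
  rw [correlator_eq_minorFunctional β r hc hc', minorFunctional_fermionMonomial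
    (K := fun a b => lineIntegral β c (r + (a : ℕ)) (r + (b : ℕ)))
    (u := fun a => I ^ n * I ^ (n - 1 - (a : ℕ)) / Real.pi) (d := Real.pi * I)
    (G := twoPoint β c) _ _ _ _ _ hm hl, minorFunctional_contourEntry_one β r hc hc', one_mul]
  · intro a
    simp [I_ne_zero, hpi]
  · exact mul_ne_zero hpi I_ne_zero
  · exact integral_contourEntry_castAdd β r
  · exact integral_contourEntry_natAdd β r hc hc'
  · intro a b
    -- The ratio of the row constants at `a` and `b` is I^(b-a), so both r and n drop out of the
    -- two-point function.
    have h : (I : ℂ) ^ (n - 1 - (a : ℕ)) =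
        I ^ ((r + ((b : ℕ) : ℤ)) - (r + ((a : ℕ) : ℤ))) * I ^ (n - 1 - (b : ℕ)) := by
      rw [← zpow_natCast, ← zpow_natCast, ← zpow_add₀ I_ne_zero]
      congr 1
      have := a.2
      have := b.2
      omega
    have hb : (I : ℂ) ^ (n - 1 - (b : ℕ)) ≠ 0 := pow_ne_zero _ I_ne_zero
    have hn : (I : ℂ) ^ n ≠ 0 := pow_ne_zero _ I_ne_zero
    have hI := I_ne_zero
    rw [twoPoint, h]
    field_simp

end correlators

end XXZ

/-- Wick's theorem for the correlators at `ν = 1/2`, on windows of sites. -/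
theorem mainTheorem7 (β : ℤ → ℝ) (c : ℝ) (hc : 0 < c) (hc' : c < Real.pi / 2) :
    (∀ (r : ℤ) (n : ℕ) (p : Fin n ↪o Fin (n + n)),
      Integrable (XXZ.corrIntegrand (1 / 2) c (XXZ.windowParams β r n) p)) ∧
    ∀ (k : ℕ) (m l : Fin k → ℤ) (r : ℤ) (n : ℕ) (r' : Fin k → Fin k → ℤ)
      (n' : Fin k → Fin k → ℕ),
      (∀ j, m j ∈ Set.Ico r (r + n)) →
      (∀ i, l i ∈ Set.Ico r (r + n)) →
      (∀ j i, m j ∈ Set.Ico (r' j i) (r' j i + n' j i) ∧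
        l i ∈ Set.Ico (r' j i) (r' j i + n' j i)) →
      XXZ.correlator (1 / 2) c β r n (XXZ.fermionMonomial r n m l) =
        Matrix.det (Matrix.of fun j i : Fin k =>
          XXZ.correlator (1 / 2) c β (r' j i) (n' j i)
            (XXZ.psi (r' j i) (n' j i) (m j) * XXZ.psiStar (r' j i) (n' j i) (l i))) := by
  refine ⟨fun r n p => XXZ.integrable_corrIntegrand β r hc hc' p, ?_⟩
  intro k m l r n r' n' hm hl hml
  rw [XXZ.correlator_fermionMonomial β r hc hc' hm hl]
  congr 1
  ext j i
  -- The case k = 1 in the window chosen for this entry: it returns the same window-free `twoPoint`.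
  have h := XXZ.correlator_fermionMonomial β (r' j i) (n := n' j i) hc hc' (k := 1)
    (m := fun _ => m j) (l := fun _ => l i) (fun _ => (hml j i).1) fun _ => (hml j i).2
  simp only [XXZ.fermionMonomial, List.ofFn_succ, List.ofFn_zero, List.prod_cons, List.prod_nil,
    mul_one, Matrix.det_unique, Matrix.of_apply] at h
  rw [Matrix.of_apply, Matrix.of_apply, h]
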